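/- **Setting.** Let $\Lambda$ be a finite set of sites with finite-dimensional local Hilbert spaces, let $\mathcal H=\bigotimes_{i\in\Lambda}\mathcal H_i$, and let $|\Psi\rangle\in\mathcal H$ be a unit vector. For a region $X\subseteq\Lambda$ and a state $|\psi\rangle$ put $\rho_X=\operatorname{Tr}_{\bar X}|\psi\rangle\langle\psi|$, $S_X=-\operatorname{Tr}(\rho_X\ln\rho_X)$ and $K_X=-\ln\rho_X$ (the logarithm being taken on the support of $\rho_X$ and extended by $0$; $K_X$ also denotes $K_X\otimes 1_{\bar X}$). Let $\mathbb D=(A,A',B,C,C')$ be five pairwise disjoint regions (possibly empty); in particular $\mathbb D$ may be any conformal ruler, i.e. such a quintuple of regions near the edge of a two-dimensional disk with the prescribed topology. Put $$\Delta=S_{AA'B}+S_{CC'B}-S_{AA'}-S_{CC'},\qquad I=S_{AB}+S_{BC}-S_B-S_{ABC},$$ $$\hat\Delta=K_{AA'B}+K_{CC'B}-K_{AA'}-K_{CC'},\qquad \hat I=K_{AB}+K_{BC}-K_B-K_{ABC}.$$ Let $\mathfrak c_{\rm tot}(\mathbb D)_{|\psi\rangle}$ be the unique positive solution $\mathfrak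 c$ of $e^{-6\Delta/\mathfrak c}+e^{-6I/\mathfrak c}=1$ if $\Delta,I>0$, and $\mathfrak c_{\rm tot}=0$ if $\Delta=0$ or $I=0$. Let $\eta=e^{-6\Delta/\mathfrak c_{\rm tot}}$ if $\Delta,I>0$; $\eta=1$ if $\Delta=0\neq I$; $\eta=0$ if $I=0\ne\Delta$; and let $\eta$ be an arbitrary number in $[0,1]$ if $\Delta=I=0$ (all these quantities for $|\Psi\rangle$). A norm-preserving perturbation of $|\Psi\rangle$ is a curve $\varepsilon\mapsto|\psi_\varepsilon\rangle$, $\varepsilon\in\mathbb R$, of unit vectors with $|\psi_0\rangle=|\Psi\rangle$ that is differentiable at $\varepsilon=0$, so that $|\psi_\varepsilon\rangle=|\Psi\rangle+\varepsilon|\Psi'\rangle+o(\varepsilon)$. Call $\mathfrak c_{\rm tot}(\mathbb D)$ stationary at $|\Psi\rangle$ if it has no nonzero first-order variation: for every norm-preserving perturbation, the derivative of $\varepsilon\mapsto\mathfrak c_{\rm tot}(\mathbb D)_{|\psi_\varepsilon\rangle}$ at $\varepsilon=0$ is zero whenever it exists. **Theorem.** (1) For every $\eta$ as above, $\mathfrak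 c_{\rm tot}(\mathbb D)$ is stationary at $|\Psi\rangle$ if and only if $$\bigl(\eta\,\hat\Delta+(1-\eta)\,\hat I\bigr)|\Psi\rangle\propto|\Psi\rangle ,$$ i.e. the left-hand side is a scalar multiple (possibly zero) of $|\Psi\rangle$. The degenerate cases $\mathfrak c_{\rm tot}=0$ are included. (2) If $\Delta$ and $I$ are both positive, or both zero, then the derivative of $\mathfrak c_{\rm tot}(\mathbb D)_{|\psi_\varepsilon\rangle}$ at $\varepsilon=0$ exists along every norm-preserving perturbation, so that stationarity then means that all these derivatives exist and vanish. -/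

import Mathlib

open scoped Matrix Kronecker ComplexConjugate

noncomputable section

/-- The many-body Hilbert space `⨂ i, ℂ^(d i)` of a finite collection `Λ` of sites: the site `i`
has an orthonormal basis labelled by the finite type `d i`, and the product basis is labelled by
the configurations `∀ i, d i`. -/
abbrev StateSpace {Λ : Type*} [Fintype Λ] [DecidableEq Λ] (d : Λ → Type*) [∀ i, Fintype (d i)] :
    Type _ :=
  EuclideanSpace ℂ (∀ i, d i)

/-- Configurations of a region `X`: labels of the product basis of `H_X`. -/
abbrev RegionConfig {Λ : Type*} (d : Λ → Type*) (X : Finset Λ) : Type _ :=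
  ∀ i : {i // i ∈ X}, d i

/-- Configurations of the complement of a region `X`. -/
abbrev ComplConfig {Λ : Type*} (d : Λ → Type*) (X : Finset Λ) : Type _ :=
  ∀ i : {i // ¬ i ∈ X}, d i

/-- The identification `H = H_X ⊗ H_{X̄}` at the level of product bases. -/
def splitConfig {Λ : Type*} [DecidableEq Λ] (d : Λ → Type*) (X : Finset Λ) :
    (∀ i, d i) ≃ RegionConfig d X × ComplConfig d X :=
  Equiv.piEquivPiSubtypeProd (fun i => i ∈ X) d

section Entropy

variable {Λ : Type*} [Fintype Λ] [DecidableEq Λ] {d : Λ → Type*} [∀ i, Fintype (d i)]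
  [∀ i, DecidableEq (d i)]

/-- The reduced density matrix `ρ_X = Tr_{X̄} |ψ⟩⟨ψ|`. -/
def reducedDensity (X : Finset Λ) (ψ : StateSpace d) :
    Matrix (RegionConfig d X) (RegionConfig d X) ℂ :=
  Matrix.of fun s t => ∑ u : ComplConfig d X,
    ψ ((splitConfig d X).symm (s, u)) * conj (ψ ((splitConfig d X).symm (t, u)))

/-- The von Neumann entropy `S_X = - Tr (ρ_X ln ρ_X)`, with `0 ln 0 = 0`. -/
def entropy (X : Finset Λ) (ψ : StateSpace d) : ℝ :=
  -(reducedDensity X ψ * cfc Real.log (reducedDensity X ψ)).trace.re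

/-- The modular Hamiltonian `K_X = - ln ρ_X`, on `H_X`. Since `Real.log 0 = 0`, the logarithm is
taken on the support of `ρ_X` and `K_X` vanishes on the kernel of `ρ_X`. -/
def modularHamiltonian (X : Finset Λ) (ψ : StateSpace d) :
    Matrix (RegionConfig d X) (RegionConfig d X) ℂ :=
  -cfc Real.log (reducedDensity X ψ)

/-- `K_X ⊗ 1_{X̄}`, as an operator on the whole Hilbert space. -/
def globalModularHamiltonian (X : Finset Λ) (ψ : StateSpace d) :
    Matrix (∀ i, d i) (∀ i, d i) ℂ :=
  (modularHamiltonian X ψ ⊗ₖ (1 : Matrix (ComplConfig d X) (ComplConfig d X) ℂ)).submatrix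
    (splitConfig d X) (splitConfig d X)

end Entropy

/-- Five pairwise disjoint regions `(A, A', B, C, C')`. A conformal ruler is such a quintuple, near
the edge of a two-dimensional disk, of a particular topology; no topology is imposed here. -/
structure Ruler (Λ : Type*) where
  A : Finset Λ
  A' : Finset Λ
  B : Finset Λ
  C : Finset Λ
  C' : Finset Λ
  disjoint_A_A' : Disjoint A A'
  disjoint_A_B : Disjoint A B
  disjoint_A_C : Disjoint A C
  disjoint_A_C' : Disjoint A C'
  disjoint_A'_B : Disjoint A' B
  disjoint_A'_C : Disjoint A' C
  disjoint_A'_C' : Disjoint A' C'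
  disjoint_B_C : Disjoint B C
  disjoint_B_C' : Disjoint B C'
  disjoint_C_C' : Disjoint C C'

/-- The central charge candidate as a function of `Δ` and `I`: the positive solution `c` of
`e^{-6Δ/c} + e^{-6I/c} = 1`, and `0` when there is none (among nonnegative `Δ`, `I` this means
`Δ = 0` or `I = 0`, see `centralCharge_spec` and `centralCharge_eq_zero`). -/
def centralCharge (Δ I : ℝ) : ℝ :=
  open Classical in
  if h : ∃ c : ℝ, 0 < c ∧ Real.exp (-6 * Δ / c) + Real.exp (-6 * I / c) = 1 then h.choose else 0

/-- For `Δ, I > 0` the equation has exactly one positive solution, namely `centralCharge Δ I`. -/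
theorem centralCharge_spec {Δ I : ℝ} (hΔ : 0 < Δ) (hI : 0 < I) (c : ℝ) :
    (0 < c ∧ Real.exp (-6 * Δ / c) + Real.exp (-6 * I / c) = 1) ↔ c = centralCharge Δ I := by
  have ex : ∃ c : ℝ, 0 < c ∧ Real.exp (-6 * Δ / c) + Real.exp (-6 * I / c) = 1 := by
    set f : ℝ → ℝ := fun x => Real.exp (-Δ * x) + Real.exp (-I * x) with hf
    have hcont : Continuous f := by fun_prop
    have hlim : Filter.Tendsto f Filter.atTop (nhds (0 + 0)) := by
      refine Filter.Tendsto.add ?_ ?_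
      · exact Real.tendsto_exp_atBot.comp
          (Filter.tendsto_id.const_mul_atTop_of_neg (by linarith))
      · exact Real.tendsto_exp_atBot.comp
          (Filter.tendsto_id.const_mul_atTop_of_neg (by linarith))
    obtain ⟨M, hM1, hM0⟩ := ((hlim.eventually (gt_mem_nhds (by norm_num : (0 : ℝ) + 0 < 1))).and
      (Filter.eventually_gt_atTop 0)).exists
    obtain ⟨x, ⟨hx0, -⟩, hx⟩ := intermediate_value_Icc' hM0.le hcont.continuousOn
      (show (1 : ℝ) ∈ Set.Icc (f M) (f 0) from ⟨hM1.le, by simp [hf]⟩)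
    have hx0' : 0 < x := by
      rcases hx0.eq_or_lt with h | h
      · rw [← h] at hx
        norm_num [hf] at hx
      · exact h
    refine ⟨6 / x, by positivity, ?_⟩
    rw [← hx]
    simp only [hf]
    congr 2 <;> field_simp
  have hspec : 0 < centralCharge Δ I ∧
      Real.exp (-6 * Δ / centralCharge Δ I) + Real.exp (-6 * I / centralCharge Δ I) = 1 := by
    unfold centralCharge
    rw [dif_pos ex]
    exact ex.choose_spec
  have mono : ∀ a b : ℝ, 0 < a → a < b →
      Real.exp (-6 * Δ / a) + Real.exp (-6 * I / a) <
        Real.exp (-6 * Δ / b) + Real.exp (-6 * I / b) := by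
    intro a b ha hab
    have hb := ha.trans hab
    have key : ∀ y : ℝ, 0 < y → Real.exp (-6 * y / a) < Real.exp (-6 * y / b) := by
      intro y hy
      rw [Real.exp_lt_exp, div_lt_div_iff₀ ha hb]
      nlinarith
    exact add_lt_add (key Δ hΔ) (key I hI)
  constructor
  · rintro ⟨hc, he⟩
    rcases lt_trichotomy c (centralCharge Δ I) with h | h | h
    · have := mono _ _ hc h
      linarith [hspec.2]
    · exact h
    · have := mono _ _ hspec.1 h
      linarith [hspec.2]
  · rintro rfl
    exact hspec

/-- The degenerate cases. -/
theorem centralCharge_eq_zero {Δ I : ℝ} (h : Δ = 0 ∨ I = 0) : centralCharge Δ I = 0 := by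
  unfold centralCharge
  rw [dif_neg]
  rintro ⟨c, -, hc⟩
  rcases h with rfl | rfl
  · have := Real.exp_pos (-6 * I / c)
    norm_num at hc
  · have := Real.exp_pos (-6 * Δ / c)
    norm_num at hc

namespace Ruler

variable {Λ : Type*} [Fintype Λ] [DecidableEq Λ] {d : Λ → Type*} [∀ i, Fintype (d i)]
  [∀ i, DecidableEq (d i)]

/-- `Δ(𝔻) = S_{AA'B} + S_{CC'B} - S_{AA'} - S_{CC'}`. -/
def delta (D : Ruler Λ) (ψ : StateSpace d) : ℝ :=
  entropy (D.A ∪ D.A' ∪ D.B) ψ + entropy (D.C ∪ D.C' ∪ D.B) ψ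
    - entropy (D.A ∪ D.A') ψ - entropy (D.C ∪ D.C') ψ

/-- `I(𝔻) = S_{AB} + S_{BC} - S_B - S_{ABC}`. -/
def info (D : Ruler Λ) (ψ : StateSpace d) : ℝ :=
  entropy (D.A ∪ D.B) ψ + entropy (D.B ∪ D.C) ψ - entropy D.B ψ - entropy (D.A ∪ D.B ∪ D.C) ψ

/-- `Δ̂(𝔻) = K_{AA'B} + K_{CC'B} - K_{AA'} - K_{CC'}`. -/
def deltaOp (D : Ruler Λ) (ψ : StateSpace d) : Matrix (∀ i, d i) (∀ i, d i) ℂ :=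
  globalModularHamiltonian (D.A ∪ D.A' ∪ D.B) ψ + globalModularHamiltonian (D.C ∪ D.C' ∪ D.B) ψ
    - globalModularHamiltonian (D.A ∪ D.A') ψ - globalModularHamiltonian (D.C ∪ D.C') ψ

/-- `Î(𝔻) = K_{AB} + K_{BC} - K_B - K_{ABC}`. -/
def infoOp (D : Ruler Λ) (ψ : StateSpace d) : Matrix (∀ i, d i) (∀ i, d i) ℂ :=
  globalModularHamiltonian (D.A ∪ D.B) ψ + globalModularHamiltonian (D.B ∪ D.C) ψ
    - globalModularHamiltonian D.B ψ - globalModularHamiltonian (D.A ∪ D.B ∪ D.C) ψ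

/-- The central charge candidate `𝔠_tot(𝔻)` of the state `ψ`. -/
def ctot (D : Ruler Λ) (ψ : StateSpace d) : ℝ :=
  centralCharge (D.delta ψ) (D.info ψ)

/-- `η` is a value of the quantum cross-ratio candidate `η(𝔻)` of the state `ψ`:
`η = e^{-6Δ/𝔠_tot}` if neither `Δ` nor `I` vanishes, `η = 1` if only `Δ` vanishes, `η = 0` if only
`I` vanishes, and any number in `[0, 1]` if both vanish. -/
def IsCrossRatio (D : Ruler Λ) (ψ : StateSpace d) (η : ℝ) : Prop :=
  (D.delta ψ ≠ 0 ∧ D.info ψ ≠ 0 ∧ η = Real.exp (-6 * D.delta ψ / D.ctot ψ)) ∨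
  (D.delta ψ = 0 ∧ D.info ψ ≠ 0 ∧ η = 1) ∨
  (D.delta ψ ≠ 0 ∧ D.info ψ = 0 ∧ η = 0) ∨
  (D.delta ψ = 0 ∧ D.info ψ = 0 ∧ η ∈ Set.Icc (0 : ℝ) 1)

/-- `𝒦_𝔻(x) = x Δ̂(𝔻) + (1 - x) Î(𝔻)`. -/
def fixedPointOp (D : Ruler Λ) (ψ : StateSpace d) (x : ℝ) : Matrix (∀ i, d i) (∀ i, d i) ℂ :=
  (x : ℂ) • D.deltaOp ψ + (1 - (x : ℂ)) • D.infoOp ψ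

/-- The vector fixed-point equation `𝒦_𝔻(η) |ψ⟩ ∝ |ψ⟩`. -/
def VectorFixedPoint (D : Ruler Λ) (ψ : StateSpace d) (η : ℝ) : Prop :=
  ∃ a : ℂ, Matrix.toEuclideanLin (D.fixedPointOp ψ η) ψ = a • ψ

end Ruler

section Stationarity

variable {Λ : Type*} [Fintype Λ] [DecidableEq Λ] {d : Λ → Type*} [∀ i, Fintype (d i)]
  [∀ i, DecidableEq (d i)]

/-- A norm-preserving perturbation `γ ε = |ψ⟩ + ε |ψ'⟩ + o(ε)` of `ψ`. -/
def IsNormPreservingPerturbation (ψ : StateSpace d) (γ : ℝ → StateSpace d) : Prop :=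
  γ 0 = ψ ∧ (∀ ε, ‖γ ε‖ = ‖ψ‖) ∧ DifferentiableAt ℝ γ 0

/-- `𝔠_tot(𝔻)` is stationary at `ψ`: it has no nonzero first-order variation under a
norm-preserving perturbation of `ψ`. In other words, along each such perturbation, its derivative
at `ψ` vanishes whenever it exists. (It can fail to exist only if exactly one of `Δ(𝔻)` and `I(𝔻)`
is zero, where `𝔠_tot` takes its minimal value `0` but may behave like `1 / ln (1/|ε|)`.) -/
def Ruler.IsStationary (D : Ruler Λ) (ψ : StateSpace d) : Prop :=
  ∀ γ : ℝ → StateSpace d, IsNormPreservingPerturbation ψ γ →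
    ∀ δc : ℝ, HasDerivAt (fun ε => D.ctot (γ ε)) δc 0 → δc = 0

end Stationarity

end

/-!
Along a norm-preserving perturbation `γ ε = Ψ + ε Φ + o(ε)`, each entropy obeys the first law
`dS_X = 2 Re ⟨Φ, K_X Ψ⟩` (`hasDerivAt_entropy`). This needs no invertibility of `ρ_X`: the weight of
`γ ε` on the kernel of `ρ_X` is `O(ε²)`, so that the eigenvalues emerging from zero contribute at most
`O(ε² ln (1/|ε|))` to the entropy. Hence `dΔ` and `dI` are the variations of the expectation values of
the fixed operators `Δ̂` and `Î`. A Hermitian operator has a stationary expectation value at `Ψ`, among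
unit vectors, exactly when `Ψ` is an eigenvector (`forall_re_inner_eq_zero_iff_exists_eq_smul`).

If `Δ, I > 0`, implicit differentiation of `e^{-6Δ/𝔠} + e^{-6I/𝔠} = 1` gives
`d𝔠 = κ (η dΔ + (1 - η) dI)` with `κ > 0` (`exists_hasDerivAt_centralCharge`), and the equivalence
follows. If `Δ` or `I` vanishes, both sides of the equivalence hold: `𝔠_tot` is at its minimal value
`0`, and so is each of `Δ`, `I` that vanishes, whose variation is therefore zero. If both vanish, the
bound `𝔠_tot ≤ 6 (Δ + I) / ln 2` (`centralCharge_le`) gives `𝔠_tot = o(ε)`.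

All of this rests on `Δ ≥ 0` and `I ≥ 0`. The second is strong subadditivity, and the first is strong
subadditivity combined with `S_X = S_{X̄}` for pure states. Strong subadditivity is deduced from the
monotonicity of the relative entropy under partial traces. With `r`, `s` the eigenvalues of `ρ`, `σ`,
`r (ln r - ln s) = ∫₀^∞ (r² / (s + t r) - r / (1 + t)) dt`, and the first part of the integrand, averaged
with the overlaps of the eigenvectors, is the maximum over matrices `X` of
`2 Re Tr (ρ X) - Tr (σ X Xᴴ) - t Tr (ρ Xᴴ X)` (`resolventForm`). Monotonicity is then immediate: a test
matrix `X` for a subsystem yields the test matrix `1 ⊗ X` for the whole system with the same value.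
-/

section

open scoped ComplexOrder InnerProductSpace
open Filter Topology Asymptotics

/-! ### Joint spectral distribution of two Hermitian matrices -/

namespace Matrix

variable {n : Type*} [Fintype n] [DecidableEq n]

theorem IsHermitian.cfc_eq_mul_diagonal_mul {A : Matrix n n ℂ} (hA : A.IsHermitian) (f : ℝ → ℝ) :
    cfc f A = (hA.eigenvectorUnitary : Matrix n n ℂ) *
      diagonal (fun i => (f (hA.eigenvalues i) : ℂ)) * (hA.eigenvectorUnitary : Matrix n n ℂ)ᴴ := by
  rw [hA.cfc_eq, IsHermitian.cfc, Unitary.conjStarAlgAut_apply]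
  rfl

theorem IsHermitian.eq_mul_diagonal_mul {A : Matrix n n ℂ} (hA : A.IsHermitian) :
    A = (hA.eigenvectorUnitary : Matrix n n ℂ) *
      diagonal (fun i => (hA.eigenvalues i : ℂ)) * (hA.eigenvectorUnitary : Matrix n n ℂ)ᴴ := by
  conv_lhs => rw [← cfc_id' ℝ A hA.isSelfAdjoint]
  rw [hA.cfc_eq_mul_diagonal_mul]

/-- The matrix of inner products of the eigenvectors of `A` with those of `B`. -/
noncomputable def overlap {A B : Matrix n n ℂ} (hA : A.IsHermitian) (hB : B.IsHermitian) :
    Matrix n n ℂ :=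
  (hA.eigenvectorUnitary : Matrix n n ℂ)ᴴ * (hB.eigenvectorUnitary : Matrix n n ℂ)

theorem IsHermitian.conjTranspose_mul_eigenvectorUnitary {A : Matrix n n ℂ} (hA : A.IsHermitian) :
    (hA.eigenvectorUnitary : Matrix n n ℂ)ᴴ * (hA.eigenvectorUnitary : Matrix n n ℂ) = 1 :=
  Unitary.coe_star_mul_self hA.eigenvectorUnitary

theorem IsHermitian.eigenvectorUnitary_mul_conjTranspose {A : Matrix n n ℂ} (hA : A.IsHermitian) :
    (hA.eigenvectorUnitary : Matrix n n ℂ) * (hA.eigenvectorUnitary : Matrix n n ℂ)ᴴ = 1 :=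
  Unitary.coe_mul_star_self hA.eigenvectorUnitary

theorem trace_diagonal_mul_mul_diagonal_mul_conjTranspose (a b : n → ℝ) (W : Matrix n n ℂ) :
    (diagonal (fun i => (a i : ℂ)) * W * diagonal (fun j => (b j : ℂ)) * Wᴴ).trace =
      ((∑ i, ∑ j, ‖W i j‖ ^ 2 * (a i * b j) : ℝ) : ℂ) := by
  simp only [trace, diag_apply]
  push_cast
  refine Finset.sum_congr rfl fun i _ => ?_
  rw [mul_apply]
  refine Finset.sum_congr rfl fun j _ => ?_
  rw [mul_diagonal, diagonal_mul, conjTranspose_apply, ← Complex.mul_conj', Complex.star_def]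
  ring

/-- Traces of products of functions of `A` and of `B` in terms of their joint spectral distribution,
the weights `‖overlap i j‖ ^ 2` on pairs of eigenvalues. -/
theorem trace_cfc_mul_cfc {A B : Matrix n n ℂ} (hA : A.IsHermitian) (hB : B.IsHermitian)
    (f g : ℝ → ℝ) :
    (cfc f A * cfc g B).trace = ((∑ i, ∑ j, ‖overlap hA hB i j‖ ^ 2 *
      (f (hA.eigenvalues i) * g (hB.eigenvalues j)) : ℝ) : ℂ) := by
  rw [← trace_diagonal_mul_mul_diagonal_mul_conjTranspose (fun i => f (hA.eigenvalues i))
    (fun j => g (hB.eigenvalues j)), hA.cfc_eq_mul_diagonal_mul, hB.cfc_eq_mul_diagonal_mul, overlap]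
  simp only [conjTranspose_mul, conjTranspose_conjTranspose, Matrix.mul_assoc]
  rw [trace_mul_comm]
  simp only [Matrix.mul_assoc]

/-- The quadratic functional of `X` whose maximum is the resolvent integrand
`Tr (ρ (σ + t ρ)⁻¹ ρ)`, with `σ` acting from the left and `ρ` from the right, of the relative
entropy of `ρ` and `σ`. -/
noncomputable def resolventForm (ρ σ : Matrix n n ℂ) (t : ℝ) (X : Matrix n n ℂ) : ℝ :=
  2 * (ρ * X).trace.re - (σ * (X * Xᴴ)).trace.re - t * (ρ * (Xᴴ * X)).trace.re

/-- In the eigenbases of `σ` and `ρ`, `resolventForm` decouples into one quadratic function per matrix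
entry. -/
theorem resolventForm_eq_sum {ρ σ : Matrix n n ℂ} (hρ : ρ.IsHermitian) (hσ : σ.IsHermitian)
    (t : ℝ) (Y : Matrix n n ℂ) :
    resolventForm ρ σ t ((hσ.eigenvectorUnitary : Matrix n n ℂ) * Y *
        (hρ.eigenvectorUnitary : Matrix n n ℂ)ᴴ) =
      ∑ i, ∑ j, (2 * hρ.eigenvalues j * (conj (overlap hσ hρ i j) * Y i j).re -
        (hσ.eigenvalues i + t * hρ.eigenvalues j) * ‖Y i j‖ ^ 2) := by
  set U := (hσ.eigenvectorUnitary : Matrix n n ℂ) with hU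
  set V := (hρ.eigenvectorUnitary : Matrix n n ℂ) with hV
  have hUU : Uᴴ * U = 1 := hσ.conjTranspose_mul_eigenvectorUnitary
  have hVV : Vᴴ * V = 1 := hρ.conjTranspose_mul_eigenvectorUnitary
  have e1 : (ρ * (U * Y * Vᴴ)).trace =
      ∑ i, ∑ j, (hρ.eigenvalues j : ℂ) * (conj (overlap hσ hρ i j) * Y i j) := by
    have : (ρ * (U * Y * Vᴴ)).trace =
        (diagonal (fun i => (hρ.eigenvalues i : ℂ)) * ((overlap hσ hρ)ᴴ * Y)).trace := by
      conv_lhs => rw [hρ.eq_mul_diagonal_mul]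
      rw [overlap, ← hU, ← hV, conjTranspose_mul, conjTranspose_conjTranspose]
      simp only [Matrix.mul_assoc]
      rw [trace_mul_comm]
      simp only [Matrix.mul_assoc, hVV, Matrix.mul_one]
    rw [this, Finset.sum_comm]
    simp only [trace, diag_apply]
    refine Finset.sum_congr rfl fun j _ => ?_
    rw [diagonal_mul, mul_apply, Finset.mul_sum]
    rfl
  have e2 : (σ * ((U * Y * Vᴴ) * (U * Y * Vᴴ)ᴴ)).trace =
      ((∑ i, ∑ j, ‖Y i j‖ ^ 2 * (hσ.eigenvalues i * 1) : ℝ) : ℂ) := by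
    rw [← trace_diagonal_mul_mul_diagonal_mul_conjTranspose hσ.eigenvalues (fun _ => 1)]
    conv_lhs => rw [hσ.eq_mul_diagonal_mul]
    simp only [← hU, conjTranspose_mul, conjTranspose_conjTranspose, Matrix.mul_assoc]
    rw [trace_mul_comm]
    simp only [Matrix.mul_assoc, Complex.ofReal_one, diagonal_one, Matrix.one_mul]
    simp only [hUU, Matrix.mul_one, ← Matrix.mul_assoc Uᴴ U, ← Matrix.mul_assoc Vᴴ V, hVV,
      Matrix.one_mul]
  have e3 : (ρ * ((U * Y * Vᴴ)ᴴ * (U * Y * Vᴴ))).trace =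
      ((∑ i, ∑ j, ‖Y i j‖ ^ 2 * (1 * hρ.eigenvalues j) : ℝ) : ℂ) := by
    rw [← trace_diagonal_mul_mul_diagonal_mul_conjTranspose (fun _ => 1) hρ.eigenvalues]
    conv_lhs => rw [hρ.eq_mul_diagonal_mul]
    simp only [← hV, conjTranspose_mul, conjTranspose_conjTranspose, Matrix.mul_assoc,
      Complex.ofReal_one, diagonal_one, Matrix.one_mul]
    rw [trace_mul_comm]
    simp only [Matrix.mul_assoc, hVV, ← Matrix.mul_assoc Uᴴ U, hUU, Matrix.one_mul,
      ← Matrix.mul_assoc Vᴴ V, Matrix.mul_one]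
    rw [← Matrix.mul_assoc, trace_mul_comm]
  rw [resolventForm, e1, e2, e3]
  simp only [Complex.ofReal_re, Complex.re_sum, Finset.mul_sum, ← Finset.sum_sub_distrib,
    Complex.re_ofReal_mul]
  refine Finset.sum_congr rfl fun i _ => Finset.sum_congr rfl fun j _ => ?_
  ring

theorem exists_eq_eigenvectorUnitary_mul {ρ σ : Matrix n n ℂ} (hρ : ρ.IsHermitian)
    (hσ : σ.IsHermitian) (X : Matrix n n ℂ) :
    ∃ Y, X = (hσ.eigenvectorUnitary : Matrix n n ℂ) * Y *
        (hρ.eigenvectorUnitary : Matrix n n ℂ)ᴴ := by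
  refine ⟨(hσ.eigenvectorUnitary : Matrix n n ℂ)ᴴ * X * (hρ.eigenvectorUnitary : Matrix n n ℂ), ?_⟩
  simp only [Matrix.mul_assoc, hρ.eigenvectorUnitary_mul_conjTranspose, Matrix.mul_one]
  rw [← Matrix.mul_assoc, hσ.eigenvectorUnitary_mul_conjTranspose, Matrix.one_mul]

/-- The maximum of `resolventForm ρ σ t`, in terms of the eigenvalues and eigenvectors. -/
noncomputable def resolventMax {ρ σ : Matrix n n ℂ} (hρ : ρ.IsHermitian) (hσ : σ.IsHermitian)
    (t : ℝ) : ℝ :=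
  ∑ i, ∑ j, ‖overlap hσ hρ i j‖ ^ 2 *
    (hρ.eigenvalues j ^ 2 / (hσ.eigenvalues i + t * hρ.eigenvalues j))

theorem resolventForm_le_resolventMax {ρ σ : Matrix n n ℂ} (hρ : ρ.PosSemidef) (hσ : σ.PosDef)
    {t : ℝ} (ht : 0 ≤ t) (X : Matrix n n ℂ) :
    resolventForm ρ σ t X ≤ resolventMax hρ.1 hσ.1 t := by
  obtain ⟨Y, rfl⟩ := exists_eq_eigenvectorUnitary_mul hρ.1 hσ.1 X
  rw [resolventForm_eq_sum, resolventMax]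
  refine Finset.sum_le_sum fun i _ => Finset.sum_le_sum fun j _ => ?_
  have hs := hσ.eigenvalues_pos i
  have hr := hρ.eigenvalues_nonneg j
  set r := hρ.1.eigenvalues j
  set s := hσ.1.eigenvalues i
  set o := overlap hσ.1 hρ.1 i j
  have hpos : 0 < s + t * r := by positivity
  have h1 : (conj o * Y i j).re ≤ ‖o‖ * ‖Y i j‖ := by
    refine (Complex.re_le_norm _).trans ?_
    rw [norm_mul, Complex.norm_conj]
  have h2 : ‖o‖ ^ 2 * (r ^ 2 / (s + t * r)) - (2 * r * (‖o‖ * ‖Y i j‖) - (s + t * r) * ‖Y i j‖ ^ 2)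
      = (r * ‖o‖ - (s + t * r) * ‖Y i j‖) ^ 2 / (s + t * r) := by
    field_simp
    ring
  have h3 : 0 ≤ (r * ‖o‖ - (s + t * r) * ‖Y i j‖) ^ 2 / (s + t * r) := by positivity
  nlinarith [mul_le_mul_of_nonneg_left h1 hr]

theorem exists_resolventForm_eq_resolventMax {ρ σ : Matrix n n ℂ} (hρ : ρ.PosSemidef)
    (hσ : σ.PosDef) {t : ℝ} (ht : 0 ≤ t) :
    ∃ X, resolventForm ρ σ t X = resolventMax hρ.1 hσ.1 t := by
  refine ⟨_, (resolventForm_eq_sum hρ.1 hσ.1 t (Matrix.of fun i j =>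
    ((hρ.1.eigenvalues j / (hσ.1.eigenvalues i + t * hρ.1.eigenvalues j) : ℝ) : ℂ) *
      overlap hσ.1 hρ.1 i j)).trans ?_⟩
  rw [resolventMax]
  refine Finset.sum_congr rfl fun i _ => Finset.sum_congr rfl fun j _ => ?_
  have hs := hσ.eigenvalues_pos i
  have hr := hρ.eigenvalues_nonneg j
  rw [of_apply]
  set r := hρ.1.eigenvalues j
  set s := hσ.1.eigenvalues i
  set o := overlap hσ.1 hρ.1 i j
  have hpos : 0 < s + t * r := by positivity
  have h1 : (conj o * (((r / (s + t * r) : ℝ) : ℂ) * o)).re = r / (s + t * r) * ‖o‖ ^ 2 := by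
    rw [mul_left_comm, Complex.conj_mul', Complex.re_ofReal_mul]
    norm_cast
  rw [h1, norm_mul, Complex.norm_real, mul_pow, Real.norm_eq_abs, sq_abs]
  field_simp
  ring

end Matrix

/-! ### Monotonicity of the relative entropy -/

namespace Matrix

variable {n : Type*} [Fintype n] [DecidableEq n]

/-- The spectrum is finite, so that `cfc` accepts every function. -/
theorem continuousOn_spectrum (f : ℝ → ℝ) (A : Matrix n n ℂ) : ContinuousOn f (spectrum ℝ A) :=
  (finite_real_spectrum (A := A)).continuousOn f

theorem IsHermitian.mul_cfc {A : Matrix n n ℂ} (hA : A.IsHermitian) (f : ℝ → ℝ) :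
    A * cfc f A = cfc (fun x => x * f x) A := by
  rw [cfc_mul (fun x : ℝ => x) f A (continuousOn_spectrum _ A) (continuousOn_spectrum _ A),
    cfc_id' ℝ A hA.isSelfAdjoint]

theorem IsHermitian.trace_cfc {A : Matrix n n ℂ} (hA : A.IsHermitian) (f : ℝ → ℝ) :
    (cfc f A).trace = ((∑ i, f (hA.eigenvalues i) : ℝ) : ℂ) := by
  rw [hA.cfc_eq_mul_diagonal_mul, Matrix.mul_assoc, trace_mul_comm, Matrix.mul_assoc,
    hA.conjTranspose_mul_eigenvectorUnitary, Matrix.mul_one, trace_diagonal]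
  push_cast
  rfl

theorem trace_cfc_eq_sum_overlap {A B : Matrix n n ℂ} (hA : A.IsHermitian) (hB : B.IsHermitian)
    (g : ℝ → ℝ) :
    (cfc g B).trace =
      ((∑ i, ∑ j, ‖overlap hA hB i j‖ ^ 2 * g (hB.eigenvalues j) : ℝ) : ℂ) := by
  have h := trace_cfc_mul_cfc hA hB (fun _ => 1) g
  rw [cfc_const_one ℝ A hA.isSelfAdjoint, Matrix.one_mul] at h
  simpa only [one_mul] using h

/-- The relative entropy `Tr ρ (ln ρ - ln σ)` as an average over the joint spectral distribution. -/
theorem re_trace_mul_log_sub {ρ σ : Matrix n n ℂ} (hρ : ρ.IsHermitian) (hσ : σ.IsHermitian) :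
    (ρ * cfc Real.log ρ).trace.re - (ρ * cfc Real.log σ).trace.re =
      ∑ i, ∑ j, ‖overlap hσ hρ i j‖ ^ 2 * (hρ.eigenvalues j *
        (Real.log (hρ.eigenvalues j) - Real.log (hσ.eigenvalues i))) := by
  have h := trace_cfc_mul_cfc hσ hρ Real.log (fun x => x)
  rw [cfc_id' ℝ ρ hρ.isSelfAdjoint] at h
  rw [hρ.mul_cfc, trace_cfc_eq_sum_overlap hσ hρ, trace_mul_comm ρ, h]
  simp only [Complex.ofReal_re, ← Finset.sum_sub_distrib]
  refine Finset.sum_congr rfl fun i _ => Finset.sum_congr rfl fun j _ => ?_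
  ring

/-- The integral of `resolventMax` over `[0, T]`, in closed form. -/
noncomputable def resolventIntegral {ρ σ : Matrix n n ℂ} (hρ : ρ.IsHermitian)
    (hσ : σ.IsHermitian) (T : ℝ) : ℝ :=
  ∑ i, ∑ j, ‖overlap hσ hρ i j‖ ^ 2 * (hρ.eigenvalues j *
    (Real.log (hσ.eigenvalues i + T * hρ.eigenvalues j) - Real.log (hσ.eigenvalues i)))

theorem resolventIntegral_zero {ρ σ : Matrix n n ℂ} (hρ : ρ.IsHermitian) (hσ : σ.IsHermitian) :
    resolventIntegral hρ hσ 0 = 0 := by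
  simp [resolventIntegral]

theorem hasDerivAt_resolventIntegral {ρ σ : Matrix n n ℂ} (hρ : ρ.PosSemidef) (hσ : σ.PosDef)
    {T : ℝ} (hT : 0 ≤ T) :
    HasDerivAt (resolventIntegral hρ.1 hσ.1) (resolventMax hρ.1 hσ.1 T) T := by
  unfold resolventIntegral resolventMax
  refine HasDerivAt.fun_sum fun i _ => HasDerivAt.fun_sum fun j _ => ?_
  have hs := hσ.eigenvalues_pos i
  have hr := hρ.eigenvalues_nonneg j
  have hpos : 0 < hσ.1.eigenvalues i + T * hρ.1.eigenvalues j := by positivity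
  have h1 : HasDerivAt (fun T : ℝ => hσ.1.eigenvalues i + T * hρ.1.eigenvalues j)
      (1 * hρ.1.eigenvalues j) T := ((hasDerivAt_id T).mul_const _).const_add _
  refine ((((h1.log hpos.ne').sub_const (Real.log (hσ.1.eigenvalues i))).const_mul
    (hρ.1.eigenvalues j)).const_mul (‖overlap hσ.1 hρ.1 i j‖ ^ 2)).congr_deriv ?_
  ring

/-- The relative entropy is the renormalized limit of `resolventIntegral`, by
`r (ln r - ln s) = lim (r ln ((s + T r) / s) - r ln T)`. -/
theorem tendsto_resolventIntegral_sub {ρ σ : Matrix n n ℂ} (hρ : ρ.PosSemidef) (hσ : σ.PosDef) :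
    Tendsto (fun T => resolventIntegral hρ.1 hσ.1 T - ρ.trace.re * Real.log T) atTop
      (𝓝 ((ρ * cfc Real.log ρ).trace.re - (ρ * cfc Real.log σ).trace.re)) := by
  have htr : ρ.trace.re = ∑ i, ∑ j, ‖overlap hσ.1 hρ.1 i j‖ ^ 2 * hρ.1.eigenvalues j := by
    have h := trace_cfc_eq_sum_overlap hσ.1 hρ.1 (fun x => x)
    rw [cfc_id' ℝ ρ hρ.1.isSelfAdjoint] at h
    rw [h, Complex.ofReal_re]
  rw [re_trace_mul_log_sub hρ.1 hσ.1]
  -- Absorb `ln T`, using `s + T r = T (s / T + r)`; eigenvalues `r = 0` contribute nothing.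
  have key : Tendsto (fun T : ℝ => ∑ i, ∑ j, ‖overlap hσ.1 hρ.1 i j‖ ^ 2 * (hρ.1.eigenvalues j *
      (Real.log (hσ.1.eigenvalues i * T⁻¹ + hρ.1.eigenvalues j) -
        Real.log (hσ.1.eigenvalues i)))) atTop (𝓝 (∑ i, ∑ j, ‖overlap hσ.1 hρ.1 i j‖ ^ 2 *
          (hρ.1.eigenvalues j * (Real.log (hρ.1.eigenvalues j) -
            Real.log (hσ.1.eigenvalues i))))) := by
    refine tendsto_finsetSum _ fun i _ => tendsto_finsetSum _ fun j _ =>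
      Tendsto.const_mul _ ?_
    rcases (hρ.eigenvalues_nonneg j).eq_or_lt with h0 | hr
    · simp [← h0]
    · refine Tendsto.const_mul _ (Tendsto.sub_const ?_ _)
      refine Tendsto.log ?_ hr.ne'
      simpa using (tendsto_inv_atTop_zero.const_mul (hσ.1.eigenvalues i)).add_const
        (hρ.1.eigenvalues j)
  refine key.congr' ?_
  filter_upwards [eventually_gt_atTop 0] with T hT
  rw [resolventIntegral, htr, Finset.sum_mul, ← Finset.sum_sub_distrib]
  refine Finset.sum_congr rfl fun i _ => ?_
  rw [Finset.sum_mul, ← Finset.sum_sub_distrib]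
  refine Finset.sum_congr rfl fun j _ => ?_
  have hs := hσ.eigenvalues_pos i
  have hr := hρ.eigenvalues_nonneg j
  have hpos : 0 < hσ.1.eigenvalues i * T⁻¹ + hρ.1.eigenvalues j := by positivity
  have : hσ.1.eigenvalues i + T * hρ.1.eigenvalues j =
      (hσ.1.eigenvalues i * T⁻¹ + hρ.1.eigenvalues j) * T := by field_simp
  rw [this, Real.log_mul hpos.ne' hT.ne']
  ring

/-- Data-processing inequality for the relative entropy, in variational form: it suffices that
every test matrix for the smaller system is matched by one for the larger system. -/
theorem relEntropy_le_of_resolventForm_le {m : Type*} [Fintype m] [DecidableEq m]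
    {ρ σ : Matrix n n ℂ} {ρ' σ' : Matrix m m ℂ}
    (hρ : ρ.PosSemidef) (hσ : σ.PosDef) (hρ' : ρ'.PosSemidef) (hσ' : σ'.PosDef)
    (htr : ρ'.trace = ρ.trace)
    (h : ∀ t X', ∃ X, resolventForm ρ' σ' t X' ≤ resolventForm ρ σ t X) :
    (ρ' * cfc Real.log ρ').trace.re - (ρ' * cfc Real.log σ').trace.re ≤
      (ρ * cfc Real.log ρ).trace.re - (ρ * cfc Real.log σ).trace.re := by
  have hle : ∀ t : ℝ, 0 ≤ t → resolventMax hρ'.1 hσ'.1 t ≤ resolventMax hρ.1 hσ.1 t := by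
    intro t ht
    obtain ⟨X', hX'⟩ := exists_resolventForm_eq_resolventMax hρ' hσ' ht
    obtain ⟨X, hX⟩ := h t X'
    exact hX' ▸ hX.trans (resolventForm_le_resolventMax hρ hσ ht X)
  have hder : ∀ t : ℝ, 0 ≤ t → HasDerivAt
      (fun T => resolventIntegral hρ.1 hσ.1 T - resolventIntegral hρ'.1 hσ'.1 T)
      (resolventMax hρ.1 hσ.1 t - resolventMax hρ'.1 hσ'.1 t) t := fun t ht =>
    (hasDerivAt_resolventIntegral hρ hσ ht).sub (hasDerivAt_resolventIntegral hρ' hσ' ht)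
  have hmono : MonotoneOn
      (fun T => resolventIntegral hρ.1 hσ.1 T - resolventIntegral hρ'.1 hσ'.1 T) (Set.Ici 0) := by
    refine monotoneOn_of_deriv_nonneg (convex_Ici 0)
      (fun t ht => (hder t ht).continuousAt.continuousWithinAt)
      (fun t ht => ?_) fun t ht => ?_
    · rw [interior_Ici] at ht
      exact (hder t ht.le).differentiableAt.differentiableWithinAt
    · rw [interior_Ici] at ht
      rw [(hder t ht.le).deriv]
      exact sub_nonneg.2 (hle t ht.le)
  refine le_of_tendsto_of_tendsto (tendsto_resolventIntegral_sub hρ' hσ')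
    (tendsto_resolventIntegral_sub hρ hσ) ?_
  filter_upwards [eventually_ge_atTop 0] with T hT
  have := hmono Set.self_mem_Ici hT hT
  simp only [resolventIntegral_zero] at this
  rw [htr]
  linarith

section PartialTraceDef

variable {e k m : Type*} [Fintype k]

/-- The partial trace over the first factor, for a factorization `f` of the product basis. -/
def partialTrace (f : e ≃ k × m) (R : Matrix e e ℂ) : Matrix m m ℂ :=
  ∑ i, R.submatrix (fun x => f.symm (i, x)) (fun x => f.symm (i, x))

theorem partialTrace_apply (f : e ≃ k × m) (R : Matrix e e ℂ) (x y : m) :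
    partialTrace f R x y = ∑ i, R (f.symm (i, x)) (f.symm (i, y)) := by
  simp [partialTrace, sum_apply]

theorem PosSemidef.partialTrace (f : e ≃ k × m) {R : Matrix e e ℂ} (hR : R.PosSemidef) :
    (partialTrace f R).PosSemidef :=
  posSemidef_sum _ fun _ _ => hR.submatrix _

end PartialTraceDef

section PartialTrace

variable {e k m : Type*} [Fintype m] [DecidableEq m] [Fintype e] [DecidableEq e]
  [Fintype k] [DecidableEq k]

/-- The embedding `N ↦ 1 ⊗ N` of the operators on a tensor factor, for a factorization `f` of the
product basis. -/
def tensorEmbed (f : e ≃ k × m) : Matrix m m ℂ →⋆ₐ[ℂ] Matrix e e ℂ where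
  toFun N := ((1 : Matrix k k ℂ) ⊗ₖ N).submatrix f f
  map_one' := by simp
  map_mul' N N' := by
    rw [submatrix_mul_equiv, ← mul_kronecker_mul, Matrix.one_mul]
  map_zero' := by simp
  map_add' N N' := by rw [kronecker_add, submatrix_add]; rfl
  commutes' c := by
    rw [algebraMap_eq_diagonal, algebraMap_eq_diagonal, ← diagonal_one, diagonal_kronecker_diagonal]
    ext i j
    simp [diagonal_apply]
  map_star' N := by
    simp only [star_eq_conjTranspose, conjTranspose_submatrix, conjTranspose_kronecker,
      conjTranspose_one]

theorem tensorEmbed_apply (f : e ≃ k × m) (N : Matrix m m ℂ) (x y : e) :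
    tensorEmbed f N x y = if (f x).1 = (f y).1 then N (f x).2 (f y).2 else 0 := by
  change (1 : Matrix k k ℂ) (f x).1 (f y).1 * N (f x).2 (f y).2 = _
  rw [one_apply, ite_mul, one_mul, zero_mul]

/-- The partial trace is dual to the embedding of the operators on the second factor. -/
theorem trace_mul_tensorEmbed (f : e ≃ k × m) (R : Matrix e e ℂ) (N : Matrix m m ℂ) :
    (R * tensorEmbed f N).trace = (partialTrace f R * N).trace := by
  simp only [trace, diag_apply, mul_apply, partialTrace_apply, tensorEmbed_apply,
    ← f.symm.sum_comp, Fintype.sum_prod_type, Equiv.apply_symm_apply, Finset.sum_mul]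
  rw [Finset.sum_comm]
  refine Finset.sum_congr rfl fun x _ => ?_
  conv_rhs => rw [Finset.sum_comm]
  refine Finset.sum_congr rfl fun i _ => ?_
  rw [Finset.sum_comm]
  refine Finset.sum_congr rfl fun y _ => ?_
  simp

theorem trace_partialTrace (f : e ≃ k × m) (R : Matrix e e ℂ) :
    (partialTrace f R).trace = R.trace := by
  have := trace_mul_tensorEmbed f R 1
  rwa [map_one, Matrix.mul_one, Matrix.mul_one, eq_comm] at this

theorem PosSemidef.tensorEmbed (f : e ≃ k × m) {N : Matrix m m ℂ} (hN : N.PosSemidef) :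
    (tensorEmbed f N).PosSemidef :=
  (PosSemidef.one.kronecker hN).submatrix f

theorem IsHermitian.cfc_tensorEmbed (f : e ≃ k × m) {N : Matrix m m ℂ} (hN : N.IsHermitian)
    (g : ℝ → ℝ) : cfc g (tensorEmbed f N) = tensorEmbed f (cfc g N) := by
  refine (StarAlgHomClass.map_cfc (R := ℝ) (S := ℂ) (tensorEmbed f) g N (continuousOn_spectrum g N)
    ?_ hN.isSelfAdjoint ?_).symm
  · exact LinearMap.continuous_of_finiteDimensional (tensorEmbed f).toAlgHom.toLinearMap
  · rw [isSelfAdjoint_iff, ← map_star, hN.isSelfAdjoint.star_eq]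

/-- Monotonicity of the relative entropy under partial traces. -/
theorem relEntropy_partialTrace_le (f : e ≃ k × m) {ρ σ : Matrix e e ℂ}
    (hρ : ρ.PosSemidef) (hσ : σ.PosDef) (hσ' : (partialTrace f σ).PosDef) :
    (partialTrace f ρ * cfc Real.log (partialTrace f ρ)).trace.re -
        (partialTrace f ρ * cfc Real.log (partialTrace f σ)).trace.re ≤
      (ρ * cfc Real.log ρ).trace.re - (ρ * cfc Real.log σ).trace.re := by
  refine relEntropy_le_of_resolventForm_le hρ hσ (hρ.partialTrace f) hσ' (trace_partialTrace f ρ)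
    fun t X => ⟨tensorEmbed f X, le_of_eq ?_⟩
  simp only [resolventForm, ← star_eq_conjTranspose, ← map_star, ← map_mul, trace_mul_tensorEmbed]

end PartialTrace

end Matrix

/-! ### Von Neumann entropy and strong subadditivity -/

namespace Matrix

section VonNeumann

variable {m n : Type*} [Fintype m] [DecidableEq m] [Fintype n] [DecidableEq n]

/-- The von Neumann entropy `-Tr (ρ ln ρ)` of a matrix. -/
noncomputable def vonNeumannEntropy (ρ : Matrix n n ℂ) : ℝ :=
  -(ρ * cfc Real.log ρ).trace.re

/-- The entropy depends on the characteristic polynomial only. -/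
theorem IsHermitian.vonNeumannEntropy_eq_sum_roots {ρ : Matrix n n ℂ} (hρ : ρ.IsHermitian) :
    vonNeumannEntropy ρ = (ρ.charpoly.roots.map fun z => Real.negMulLog z.re).sum := by
  rw [vonNeumannEntropy, hρ.mul_cfc, hρ.trace_cfc, hρ.roots_charpoly_eq_eigenvalues,
    Multiset.map_map, Complex.ofReal_re, ← Finset.sum_neg_distrib, Finset.sum_eq_multiset_sum]
  simp [Function.comp_def, Real.negMulLog]

theorem vonNeumannEntropy_transpose {ρ : Matrix n n ℂ} (hρ : ρ.IsHermitian) :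
    vonNeumannEntropy ρᵀ = vonNeumannEntropy ρ := by
  rw [hρ.vonNeumannEntropy_eq_sum_roots, hρ.transpose.vonNeumannEntropy_eq_sum_roots,
    charpoly_transpose]

theorem vonNeumannEntropy_reindex (u : n ≃ m) {ρ : Matrix n n ℂ} (hρ : ρ.IsHermitian) :
    vonNeumannEntropy (reindex u u ρ) = vonNeumannEntropy ρ := by
  have h : (reindex u u ρ).IsHermitian := hρ.submatrix _
  rw [hρ.vonNeumannEntropy_eq_sum_roots, h.vonNeumannEntropy_eq_sum_roots, charpoly_reindex]

/-- `M Mᴴ` and `Mᴴ M` have the same nonzero spectrum. -/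
theorem vonNeumannEntropy_mul_conjTranspose (M : Matrix m n ℂ) :
    vonNeumannEntropy (M * Mᴴ) = vonNeumannEntropy (Mᴴ * M) := by
  rw [(isHermitian_mul_conjTranspose_self M).vonNeumannEntropy_eq_sum_roots,
    (isHermitian_conjTranspose_mul_self M).vonNeumannEntropy_eq_sum_roots]
  have h := congrArg (fun p => (p.roots.map fun z : ℂ => Real.negMulLog z.re).sum)
    (charpoly_mul_comm' M Mᴴ)
  have hX : ∀ k : ℕ, (Polynomial.X ^ k : Polynomial ℂ) ≠ 0 := fun k =>
    pow_ne_zero _ Polynomial.X_ne_zero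
  rw [Polynomial.roots_mul (mul_ne_zero (hX _) (charpoly_monic _).ne_zero),
    Polynomial.roots_mul (mul_ne_zero (hX _) (charpoly_monic _).ne_zero)] at h
  simpa [Multiset.map_nsmul, Multiset.sum_nsmul] using h

/-- Removal of the regularization: `Tr ρ ln (ρ + κ δ)` converges although `ρ` may have a kernel, since
`r ln (r + κ δ) = 0` for `r = 0`. -/
theorem tendsto_re_trace_mul_log_add {ρ : Matrix n n ℂ} (hρ : ρ.PosSemidef) (κ : ℝ) :
    Tendsto (fun δ : ℝ => (ρ * cfc Real.log (ρ + algebraMap ℝ _ (κ * δ))).trace.re) (𝓝[>] 0)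
      (𝓝 (-vonNeumannEntropy ρ)) := by
  have h : ∀ δ : ℝ, (ρ * cfc Real.log (ρ + algebraMap ℝ _ (κ * δ))).trace.re =
      ∑ i, hρ.1.eigenvalues i * Real.log (hρ.1.eigenvalues i + κ * δ) := by
    intro δ
    have h1 : ρ + algebraMap ℝ _ (κ * δ) = cfc (fun x : ℝ => x + κ * δ) ρ := by
      rw [cfc_add_const (κ * δ) (fun x : ℝ => x) ρ (continuousOn_spectrum _ _)
        hρ.1.isSelfAdjoint, cfc_id' ℝ ρ hρ.1.isSelfAdjoint]
    have h2 : cfc Real.log (cfc (fun x : ℝ => x + κ * δ) ρ) =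
        cfc (fun x : ℝ => Real.log (x + κ * δ)) ρ := by
      refine (cfc_comp' Real.log (fun x : ℝ => x + κ * δ) ρ ?_ (continuousOn_spectrum _ _)
        hρ.1.isSelfAdjoint).symm
      exact ((finite_real_spectrum (A := ρ)).image _).continuousOn _
    rw [h1, h2, hρ.1.mul_cfc, hρ.1.trace_cfc, Complex.ofReal_re]
  simp only [h]
  rw [vonNeumannEntropy, neg_neg, hρ.1.mul_cfc, hρ.1.trace_cfc, Complex.ofReal_re]
  refine tendsto_finsetSum _ fun i _ => ?_
  rcases (hρ.eigenvalues_nonneg i).eq_or_lt with h0 | h0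
  · simp [← h0]
  · refine Tendsto.const_mul _ (Tendsto.log ?_ h0.ne')
    refine tendsto_nhdsWithin_of_tendsto_nhds ?_
    have : ContinuousAt (fun δ : ℝ => hρ.1.eigenvalues i + κ * δ) 0 := by fun_prop
    simpa [ContinuousAt] using this

theorem PosSemidef.posDef_add_algebraMap {ρ : Matrix n n ℂ} (hρ : ρ.PosSemidef) {δ : ℝ}
    (hδ : 0 < δ) : (ρ + algebraMap ℝ _ δ).PosDef := by
  rw [Algebra.algebraMap_eq_smul_one]
  exact (PosDef.one.smul hδ).posSemidef_add hρ

end VonNeumann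

section StrongSubadditivity

variable {a b c : Type*} [Fintype a] [DecidableEq a] [Fintype b] [DecidableEq b] [Fintype c]
  [DecidableEq c]

theorem partialTrace_tensorEmbed (N : Matrix (b × c) (b × c) ℂ) :
    partialTrace (Equiv.prodComm (a × b) c) (tensorEmbed (Equiv.prodAssoc a b c) N) =
      tensorEmbed (Equiv.refl (a × b)) (partialTrace (Equiv.prodComm b c) N) := by
  ext ⟨i, j⟩ ⟨i', j'⟩
  simp only [partialTrace_apply, tensorEmbed_apply]
  by_cases h : i = i' <;> simp [h]

theorem partialTrace_add {e k m : Type*} [Fintype k] (f : e ≃ k × m) (R R' : Matrix e e ℂ) :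
    partialTrace f (R + R') = partialTrace f R + partialTrace f R' := by
  ext x y
  simp [partialTrace_apply, Finset.sum_add_distrib]

theorem partialTrace_algebraMap {e k m : Type*} [Fintype k] [Fintype m] [Fintype e] [DecidableEq e]
    [DecidableEq k] [DecidableEq m] (f : e ≃ k × m) (δ : ℝ) :
    partialTrace f (algebraMap ℝ (Matrix e e ℂ) δ) = algebraMap ℝ _ (Fintype.card k * δ) := by
  ext x y
  simp [partialTrace_apply, algebraMap_matrix_apply]

/-- Strong subadditivity of the von Neumann entropy. -/
theorem vonNeumannEntropy_strong_subadditivity [Nonempty c]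
    {R : Matrix ((a × b) × c) ((a × b) × c) ℂ} (hR : R.PosSemidef) :
    vonNeumannEntropy R + vonNeumannEntropy (partialTrace (Equiv.refl (a × b))
        (partialTrace (Equiv.prodComm (a × b) c) R)) ≤
      vonNeumannEntropy (partialTrace (Equiv.prodComm (a × b) c) R) +
        vonNeumannEntropy (partialTrace (Equiv.prodAssoc a b c) R) := by
  set Rab := partialTrace (Equiv.prodComm (a × b) c) R with hRab
  set Rbc := partialTrace (Equiv.prodAssoc a b c) R with hRbc
  set Rb := partialTrace (Equiv.refl (a × b)) Rab with hRb
  have pab : Rab.PosSemidef := hR.partialTrace _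
  have pbc : Rbc.PosSemidef := hR.partialTrace _
  have pb : Rb.PosSemidef := pab.partialTrace _
  have hb : partialTrace (Equiv.prodComm b c) Rbc = Rb := by
    ext x y
    simp only [hRb, hRab, hRbc, partialTrace_apply]
    exact Finset.sum_comm
  have hcard : (0 : ℝ) < Fintype.card c := Nat.cast_pos.2 Fintype.card_pos
  -- Monotonicity for `ρ = R` and the regularization `σ = 1 ⊗ (Rbc + δ)` of `1 ⊗ Rbc`.
  have key : ∀ δ : ℝ, 0 < δ →
      (Rab * cfc Real.log Rab).trace.re -
        (Rb * cfc Real.log (Rb + algebraMap ℝ _ (Fintype.card c * δ))).trace.re ≤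
      (R * cfc Real.log R).trace.re -
        (Rbc * cfc Real.log (Rbc + algebraMap ℝ _ (1 * δ))).trace.re := by
    intro δ hδ
    have e1 : tensorEmbed (Equiv.prodAssoc a b c) (Rbc + algebraMap ℝ _ (1 * δ)) =
        tensorEmbed (Equiv.prodAssoc a b c) Rbc + algebraMap ℝ _ δ := by
      rw [map_add, one_mul, IsScalarTower.algebraMap_apply ℝ ℂ (Matrix _ _ ℂ), AlgHomClass.commutes,
        ← IsScalarTower.algebraMap_apply]
    have e2 : partialTrace (Equiv.prodComm (a × b) c)
        (tensorEmbed (Equiv.prodAssoc a b c) (Rbc + algebraMap ℝ _ (1 * δ))) =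
        tensorEmbed (Equiv.refl (a × b)) (Rb + algebraMap ℝ _ (Fintype.card c * δ)) := by
      rw [partialTrace_tensorEmbed, partialTrace_add, hb, partialTrace_algebraMap, one_mul]
    have e3 : tensorEmbed (Equiv.refl (a × b)) (Rb + algebraMap ℝ _ (Fintype.card c * δ)) =
        tensorEmbed (Equiv.refl (a × b)) Rb + algebraMap ℝ _ (Fintype.card c * δ) := by
      rw [map_add, IsScalarTower.algebraMap_apply ℝ ℂ (Matrix _ _ ℂ), AlgHomClass.commutes,
        ← IsScalarTower.algebraMap_apply]
    have h := relEntropy_partialTrace_le (Equiv.prodComm (a × b) c) hR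
      (σ := tensorEmbed (Equiv.prodAssoc a b c) (Rbc + algebraMap ℝ _ (1 * δ)))
      (e1 ▸ (pbc.tensorEmbed _).posDef_add_algebraMap hδ)
      (e2 ▸ e3 ▸ (pb.tensorEmbed _).posDef_add_algebraMap (mul_pos hcard hδ))
    rwa [e2, IsHermitian.cfc_tensorEmbed, IsHermitian.cfc_tensorEmbed, trace_mul_tensorEmbed,
      trace_mul_tensorEmbed] at h
    · exact (pbc.posDef_add_algebraMap (by simpa using hδ)).1
    · exact (pb.posDef_add_algebraMap (mul_pos hcard hδ)).1
  have hlim := le_of_tendsto_of_tendsto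
    ((tendsto_re_trace_mul_log_add pb _).const_sub (Rab * cfc Real.log Rab).trace.re)
    ((tendsto_re_trace_mul_log_add pbc 1).const_sub (R * cfc Real.log R).trace.re)
    (eventually_nhdsWithin_of_forall fun δ hδ => key δ hδ)
  have hR' : vonNeumannEntropy R = -(R * cfc Real.log R).trace.re := rfl
  have hRab' : vonNeumannEntropy Rab = -(Rab * cfc Real.log Rab).trace.re := rfl
  linarith

end StrongSubadditivity

end Matrix

/-! ### Entropies of regions of a pure state -/

namespace Matrix

/-- Partial traces for two factorizations with the same notions of agreement on the two factors
differ by a relabelling of the basis. -/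
theorem vonNeumannEntropy_partialTrace_congr {e k m k' m' : Type*} [Fintype e] [DecidableEq e]
    [Fintype k] [Fintype m] [DecidableEq m] [Fintype k'] [Fintype m']
    [DecidableEq m'] [Nonempty e] (g : e ≃ k × m) (g' : e ≃ k' × m')
    (h₁ : ∀ x y, (g x).1 = (g y).1 ↔ (g' x).1 = (g' y).1)
    (h₂ : ∀ x y, (g x).2 = (g y).2 ↔ (g' x).2 = (g' y).2) {R : Matrix e e ℂ}
    (hR : R.PosSemidef) :
    vonNeumannEntropy (partialTrace g R) = vonNeumannEntropy (partialTrace g' R) := by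
  obtain ⟨x₀⟩ := ‹Nonempty e›
  let u : m ≃ m' :=
    { toFun := fun i => (g' (g.symm ((g x₀).1, i))).2
      invFun := fun i => (g (g'.symm ((g' x₀).1, i))).2
      left_inv := fun i => by
        have := (h₂ (g'.symm ((g' x₀).1, (g' (g.symm ((g x₀).1, i))).2))
          (g.symm ((g x₀).1, i))).2 (by simp)
        simpa using this
      right_inv := fun i => by
        have := (h₂ (g.symm ((g x₀).1, (g (g'.symm ((g' x₀).1, i))).2))
          (g'.symm ((g' x₀).1, i))).1 (by simp)
        simpa using this }
  let v : k ≃ k' :=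
    { toFun := fun i => (g' (g.symm (i, (g x₀).2))).1
      invFun := fun i => (g (g'.symm (i, (g' x₀).2))).1
      left_inv := fun i => by
        have := (h₁ (g'.symm ((g' (g.symm (i, (g x₀).2))).1, (g' x₀).2))
          (g.symm (i, (g x₀).2))).2 (by simp)
        simpa using this
      right_inv := fun i => by
        have := (h₁ (g.symm ((g (g'.symm (i, (g' x₀).2))).1, (g x₀).2))
          (g'.symm (i, (g' x₀).2))).1 (by simp)
        simpa using this }
  have huv : ∀ i j, g'.symm (v i, u j) = g.symm (i, j) := by
    intro i j
    rw [Equiv.symm_apply_eq]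
    ext1
    · exact (h₁ _ _).1 (by simp)
    · exact (h₂ _ _).1 (by simp)
  have : partialTrace g' R = reindex u u (partialTrace g R) := by
    ext x y
    obtain ⟨x, rfl⟩ := u.surjective x
    obtain ⟨y, rfl⟩ := u.surjective y
    simp only [reindex_apply, submatrix_apply, Equiv.symm_apply_apply, partialTrace_apply]
    rw [← v.sum_comp]
    simp only [huv]
  rw [this, vonNeumannEntropy_reindex u (hR.partialTrace g).1]

theorem partialTrace_partialTrace {e k m k' m' : Type*} [Fintype k] [Fintype k'] (g : e ≃ k × m)
    (f : m ≃ k' × m') (R : Matrix e e ℂ) :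
    partialTrace f (partialTrace g R) = partialTrace
      (g.trans (((Equiv.refl k).prodCongr f).trans (Equiv.prodAssoc k k' m').symm)) R := by
  ext x y
  simp only [partialTrace_apply, Fintype.sum_prod_type]
  rw [Finset.sum_comm]
  rfl

end Matrix


open Matrix

section Regions

variable {Λ : Type*} [DecidableEq Λ] {d : Λ → Type*}

/-- The factorization `H = H_{X̄} ⊗ H_X`, with the region `X` last. -/
def regionFactor (d : Λ → Type*) (X : Finset Λ) :
    (∀ i, d i) ≃ ComplConfig d X × RegionConfig d X :=
  (splitConfig d X).trans (Equiv.prodComm _ _)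

theorem regionFactor_fst_eq_iff (X : Finset Λ) (x y : ∀ i, d i) :
    (regionFactor d X x).1 = (regionFactor d X y).1 ↔ ∀ i ∉ X, x i = y i := by
  simp only [funext_iff, Subtype.forall]
  rfl

theorem regionFactor_snd_eq_iff (X : Finset Λ) (x y : ∀ i, d i) :
    (regionFactor d X x).2 = (regionFactor d X y).2 ↔ ∀ i ∈ X, x i = y i := by
  simp only [funext_iff, Subtype.forall]
  rfl

variable [Fintype Λ] [∀ i, Fintype (d i)]

/-- The density matrix `|ψ⟩⟨ψ|` of a pure state. -/
def pureDensity (ψ : StateSpace d) : Matrix (∀ i, d i) (∀ i, d i) ℂ :=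
  vecMulVec ψ.ofLp (star ψ.ofLp)

theorem pureDensity_posSemidef (ψ : StateSpace d) : (pureDensity ψ).PosSemidef :=
  posSemidef_vecMulVec_self_star _

theorem reducedDensity_eq_partialTrace (X : Finset Λ) (ψ : StateSpace d) :
    reducedDensity X ψ = partialTrace (regionFactor d X) (pureDensity ψ) := by
  ext s t
  rw [partialTrace_apply]
  rfl

theorem reducedDensity_posSemidef (X : Finset Λ) (ψ : StateSpace d) :
    (reducedDensity X ψ).PosSemidef := by
  rw [reducedDensity_eq_partialTrace]
  exact (pureDensity_posSemidef ψ).partialTrace _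

variable [∀ i, DecidableEq (d i)]

theorem entropy_eq_vonNeumannEntropy (X : Finset Λ) (ψ : StateSpace d) :
    entropy X ψ = vonNeumannEntropy (reducedDensity X ψ) :=
  rfl

/-- The entropy of `X` may be computed from any factorization of the product basis whose two factors
record the configuration outside and inside `X`. -/
theorem entropy_eq_of_factorization [Nonempty (∀ i, d i)] {k m : Type*} [Fintype k] [Fintype m]
    [DecidableEq m] (X : Finset Λ) (ψ : StateSpace d) (g : (∀ i, d i) ≃ k × m)
    (h₁ : ∀ x y, (g x).1 = (g y).1 ↔ ∀ i ∉ X, x i = y i)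
    (h₂ : ∀ x y, (g x).2 = (g y).2 ↔ ∀ i ∈ X, x i = y i) :
    entropy X ψ = vonNeumannEntropy (partialTrace g (pureDensity ψ)) := by
  rw [entropy_eq_vonNeumannEntropy, reducedDensity_eq_partialTrace]
  refine vonNeumannEntropy_partialTrace_congr _ _ (fun x y => ?_) (fun x y => ?_)
    (pureDensity_posSemidef ψ)
  · rw [h₁, regionFactor_fst_eq_iff]
  · rw [h₂, regionFactor_snd_eq_iff]

/-- Complementary regions have the same entropy in a pure state. -/
theorem entropy_compl [Nonempty (∀ i, d i)] (X : Finset Λ) (ψ : StateSpace d) :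
    entropy Xᶜ ψ = entropy X ψ := by
  rw [entropy_eq_of_factorization Xᶜ ψ (splitConfig d X)]
  · set M : Matrix (RegionConfig d X) (ComplConfig d X) ℂ :=
      Matrix.of fun s u => ψ ((splitConfig d X).symm (s, u)) with hM
    have h1 : reducedDensity X ψ = M * Mᴴ := by
      ext s t
      simp [reducedDensity, mul_apply, hM]
    have h2 : partialTrace (splitConfig d X) (pureDensity ψ) = (Mᴴ * M)ᵀ := by
      ext s t
      simp [partialTrace_apply, pureDensity, mul_apply, hM, vecMulVec_apply, mul_comm]
    rw [h2, vonNeumannEntropy_transpose (isHermitian_conjTranspose_mul_self M),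
      entropy_eq_vonNeumannEntropy, h1, vonNeumannEntropy_mul_conjTranspose]
  · intro x y
    simp only [Finset.mem_compl, not_not]
    exact regionFactor_snd_eq_iff X x y
  · intro x y
    simp only [Finset.mem_compl]
    exact regionFactor_fst_eq_iff X x y

/-- The factorization of the product basis for three disjoint regions and the rest. -/
noncomputable def tripleFactor (d : Λ → Type*) {X Y Z : Finset Λ} (hXY : Disjoint X Y)
    (hXZ : Disjoint X Z) (hYZ : Disjoint Y Z) : (∀ i, d i) ≃
      ComplConfig d (X ∪ Y ∪ Z) × ((RegionConfig d X × RegionConfig d Y) × RegionConfig d Z) :=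
  Equiv.ofBijective (fun x => (fun i => x i, (fun i => x i, fun i => x i), fun i => x i)) <| by
    constructor
    · intro x y h
      simp only [Prod.mk.injEq, funext_iff, Subtype.forall, Finset.mem_union] at h
      obtain ⟨h0, ⟨hX, hY⟩, hZ⟩ := h
      funext i
      by_cases h1 : i ∈ X
      · exact hX i h1
      by_cases h2 : i ∈ Y
      · exact hY i h2
      by_cases h3 : i ∈ Z
      · exact hZ i h3
      exact h0 i (by tauto)
    · rintro ⟨w, ⟨x, y⟩, z⟩
      refine ⟨fun i => if hX : i ∈ X then x ⟨i, hX⟩ else if hY : i ∈ Y then y ⟨i, hY⟩ else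
        if hZ : i ∈ Z then z ⟨i, hZ⟩ else w ⟨i, by simp [hX, hY, hZ]⟩, ?_⟩
      simp only [Prod.mk.injEq, funext_iff, Subtype.forall]
      refine ⟨fun i hi => ?_, ⟨fun i hi => ?_, fun i hi => ?_⟩, fun i hi => ?_⟩
      · simp only [Finset.mem_union, not_or] at hi
        simp [hi]
      · simp [hi]
      · simp [hi, Finset.disjoint_right.1 hXY hi]
      · simp [hi, Finset.disjoint_right.1 hXZ hi, Finset.disjoint_right.1 hYZ hi]

/-- Strong subadditivity for three disjoint regions of a pure state. -/
theorem entropy_strong_subadditivity [Nonempty (∀ i, d i)] {X Y Z : Finset Λ}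
    (hXY : Disjoint X Y) (hXZ : Disjoint X Z) (hYZ : Disjoint Y Z) (ψ : StateSpace d) :
    entropy (X ∪ Y ∪ Z) ψ + entropy Y ψ ≤ entropy (X ∪ Y) ψ + entropy (Y ∪ Z) ψ := by
  have : Nonempty (RegionConfig d Z) :=
    (inferInstance : Nonempty (∀ i, d i)).map fun x i => x i
  have h := vonNeumannEntropy_strong_subadditivity
    ((pureDensity_posSemidef ψ).partialTrace (tripleFactor d hXY hXZ hYZ))
  have hX : ∀ i, i ∈ X → i ∉ Y ∧ i ∉ Z := fun i hi =>
    ⟨Finset.disjoint_left.1 hXY hi, Finset.disjoint_left.1 hXZ hi⟩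
  have hY : ∀ i, i ∈ Y → i ∉ Z := fun i hi => Finset.disjoint_left.1 hYZ hi
  simp only [partialTrace_partialTrace] at h
  have key : ∀ x y : ∀ i, d i, ((tripleFactor d hXY hXZ hYZ x).1 = (tripleFactor d hXY hXZ hYZ y).1
      ↔ ∀ i ∉ X ∪ Y ∪ Z, x i = y i) ∧ ((tripleFactor d hXY hXZ hYZ x).2.1.1 =
      (tripleFactor d hXY hXZ hYZ y).2.1.1 ↔ ∀ i ∈ X, x i = y i) ∧
      ((tripleFactor d hXY hXZ hYZ x).2.1.2 =
      (tripleFactor d hXY hXZ hYZ y).2.1.2 ↔ ∀ i ∈ Y, x i = y i) ∧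
      ((tripleFactor d hXY hXZ hYZ x).2.2 =
      (tripleFactor d hXY hXZ hYZ y).2.2 ↔ ∀ i ∈ Z, x i = y i) := fun x y => by
    simp only [funext_iff, Subtype.forall]
    exact ⟨Iff.rfl, Iff.rfl, Iff.rfl, Iff.rfl⟩
  convert h using 2
  all_goals
    refine entropy_eq_of_factorization _ ψ _ ?_ ?_
  all_goals
    intro x y
    obtain ⟨k1, k2, k3, k4⟩ := key x y
    simp only [Equiv.trans_apply, Equiv.prodCongr_apply, Equiv.prodAssoc_symm_apply,
      Equiv.prodAssoc_apply, Equiv.prodComm_apply, Equiv.coe_refl, Prod.map, Prod.fst_swap,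
      Prod.snd_swap, id_eq, Prod.ext_iff, k1, k2, k3, k4, Finset.mem_union] <;> grind

/-- `I(𝔻)` is a conditional mutual information. -/
theorem Ruler.info_nonneg [Nonempty (∀ i, d i)] (D : Ruler Λ) (ψ : StateSpace d) :
    0 ≤ D.info ψ := by
  have := entropy_strong_subadditivity D.disjoint_A_B D.disjoint_A_C D.disjoint_B_C ψ
  rw [Ruler.info]
  linarith

/-- By purity, `Δ(𝔻)` is the conditional mutual information of `B` and the complement of
`AA'BCC'` given `AA'`. -/
theorem Ruler.delta_nonneg [Nonempty (∀ i, d i)] (D : Ruler Λ) (ψ : StateSpace d) :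
    0 ≤ D.delta ψ := by
  obtain ⟨A, A', B, C, C', h1, h2, h3, h4, h5, h6, h7, h8, h9, h10⟩ := D
  simp only [Ruler.delta]
  simp only [Finset.disjoint_left] at h1 h2 h3 h4 h5 h6 h7 h8 h9 h10
  have h := entropy_strong_subadditivity (X := B) (Y := A ∪ A') (Z := (A ∪ A' ∪ B ∪ C ∪ C')ᶜ)
    (by rw [Finset.disjoint_left]; grind [Finset.mem_compl])
    (by rw [Finset.disjoint_left]; grind [Finset.mem_compl])
    (by rw [Finset.disjoint_left]; grind [Finset.mem_compl]) ψ
  have e1 : B ∪ (A ∪ A') ∪ (A ∪ A' ∪ B ∪ C ∪ C')ᶜ = (C ∪ C')ᶜ := by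
    ext i
    simp only [Finset.mem_union, Finset.mem_compl]
    grind
  have e2 : A ∪ A' ∪ (A ∪ A' ∪ B ∪ C ∪ C')ᶜ = (C ∪ C' ∪ B)ᶜ := by
    ext i
    simp only [Finset.mem_union, Finset.mem_compl]
    grind
  rw [e1, e2, entropy_compl, entropy_compl, Finset.union_comm B] at h
  linarith

end Regions

/-! ### First-order expansion of the von Neumann entropy -/

/-- Second-order Taylor bound for `r ln (r / s)` at `r = s`, uniform in `r ≥ 0`. -/
theorem abs_mul_log_sub_log_sub_le {r s : ℝ} (hr : 0 ≤ r) (hs : 0 < s) :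
    |r * (Real.log r - Real.log s) - (r - s)| ≤ (r - s) ^ 2 * s⁻¹ := by
  rcases hr.eq_or_lt with rfl | hr
  · simp only [zero_mul, zero_sub, neg_neg, abs_of_pos hs, neg_sq]
    field_simp
    rfl
  have h1 := Real.log_le_sub_one_of_pos (div_pos hr hs)
  have h2 := Real.log_le_sub_one_of_pos (div_pos hs hr)
  rw [Real.log_div hr.ne' hs.ne'] at h1
  rw [Real.log_div hs.ne' hr.ne'] at h2
  have h3 := mul_le_mul_of_nonneg_left h1 hr.le
  have h4 := mul_le_mul_of_nonneg_left h2 hr.le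
  have e1 : r * (s / r - 1) = s - r := by field_simp
  have e2 : r * (r / s - 1) = (r - s) ^ 2 * s⁻¹ + (r - s) := by field_simp; ring
  have h5 : 0 ≤ (r - s) ^ 2 * s⁻¹ := by positivity
  rw [abs_le]
  constructor <;> nlinarith

/-- On `[0, 1]`, the concave function `-r ln r` is nonnegative and lies below its tangent at `s`. -/
theorem abs_mul_log_le {r s : ℝ} (hr : 0 ≤ r) (hr1 : r ≤ 1) (hs : 0 < s) :
    |r * Real.log r| ≤ r * -Real.log s + s := by
  rcases hr.eq_or_lt with rfl | hr
  · simpa using hs.le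
  have h1 : r * Real.log r ≤ 0 :=
    mul_nonpos_of_nonneg_of_nonpos hr.le (Real.log_nonpos hr.le hr1)
  have h2 := Real.log_le_sub_one_of_pos (div_pos hs hr)
  rw [Real.log_div hs.ne' hr.ne'] at h2
  have h3 := mul_le_mul_of_nonneg_left h2 hr.le
  have e1 : r * (s / r - 1) = s - r := by field_simp
  rw [abs_of_nonpos h1]
  nlinarith

namespace Matrix

variable {n : Type*} [Fintype n] [DecidableEq n]

/-- The orthogonal projection onto the kernel of a Hermitian matrix. -/
noncomputable def kerProj (ρ : Matrix n n ℂ) : Matrix n n ℂ :=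
  cfc (fun x : ℝ => if x = 0 then 1 else 0) ρ

theorem kerProj_mul_self (ρ : Matrix n n ℂ) : kerProj ρ * kerProj ρ = kerProj ρ := by
  rw [kerProj, ← cfc_mul _ _ ρ (continuousOn_spectrum _ _) (continuousOn_spectrum _ _)]
  congr 1
  funext x
  simp

theorem isHermitian_cfc (f : ℝ → ℝ) (ρ : Matrix n n ℂ) : (cfc f ρ).IsHermitian :=
  cfc_predicate f ρ

theorem IsHermitian.mul_kerProj {ρ : Matrix n n ℂ} (hρ : ρ.IsHermitian) : ρ * kerProj ρ = 0 := by
  rw [kerProj, hρ.mul_cfc]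
  have : (fun x : ℝ => x * if x = 0 then 1 else 0) = fun _ => 0 := by
    funext x
    simp
  rw [this, cfc_const_zero ℝ ρ]

/-- First-order expansion of the von Neumann entropy at `ρ₀`, with an explicit remainder that
accounts for the eigenvalues of `ρ` emerging from the kernel of `ρ₀`: their contribution `-r ln r` is
estimated by the tangent at the free parameter `s`. -/
theorem PosSemidef.exists_abs_vonNeumannEntropy_add_le {ρ₀ : Matrix n n ℂ} (hρ₀ : ρ₀.PosSemidef) :
    ∃ C : ℝ, 0 ≤ C ∧ ∀ ρ : Matrix n n ℂ, ρ.PosSemidef → ρ.trace = 1 → ρ₀.trace = 1 → ∀ s : ℝ, 0 < s →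
      |vonNeumannEntropy ρ + (ρ * cfc Real.log ρ₀).trace.re| ≤
        (ρ * kerProj ρ₀).trace.re * (1 - Real.log s) + Fintype.card n * s +
          C * ((ρ - ρ₀) * (ρ - ρ₀)).trace.re := by
  have hs₀ := hρ₀.eigenvalues_nonneg
  refine ⟨∑ i, (hρ₀.1.eigenvalues i)⁻¹, Finset.sum_nonneg fun i _ => inv_nonneg.2 (hs₀ i), ?_⟩
  intro ρ hρ htr htr₀ s hs
  have hr := hρ.eigenvalues_nonneg
  have hr1 : ∀ j, hρ.1.eigenvalues j ≤ 1 := by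
    intro j
    have h1 : (∑ j, hρ.1.eigenvalues j : ℝ) = 1 := by
      have := hρ.1.trace_eq_sum_eigenvalues
      rw [htr] at this
      have h2 := congrArg Complex.re this.symm
      rw [Complex.re_sum] at h2
      simpa using h2
    rw [← h1]
    exact Finset.single_le_sum (fun i _ => hr i) (Finset.mem_univ j)
  -- Zero eigenvalues do not contribute to `C`, since `0⁻¹ = 0`.
  set C := ∑ i, (hρ₀.1.eigenvalues i)⁻¹ with hC
  have hCi : ∀ i, (hρ₀.1.eigenvalues i)⁻¹ ≤ C := fun i =>
    Finset.single_le_sum (f := fun i => (hρ₀.1.eigenvalues i)⁻¹)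
      (fun i _ => inv_nonneg.2 (hs₀ i)) (Finset.mem_univ i)
  have hC0 : 0 ≤ C := Finset.sum_nonneg fun i _ => inv_nonneg.2 (hs₀ i)
  set w := fun i j => ‖overlap hρ₀.1 hρ.1 i j‖ ^ 2 with hw
  set σ := hρ₀.1.eigenvalues with hσ
  set r := hρ.1.eigenvalues with hr'
  have T : ∀ f g : ℝ → ℝ, (cfc f ρ₀ * cfc g ρ).trace.re = ∑ i, ∑ j, w i j * (f (σ i) * g (r j)) :=
    fun f g => by rw [trace_cfc_mul_cfc hρ₀.1 hρ.1, Complex.ofReal_re]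
  have i0 : cfc (fun x : ℝ => x) ρ₀ = ρ₀ := cfc_id' ℝ ρ₀ hρ₀.1.isSelfAdjoint
  have i1 : cfc (fun x : ℝ => x) ρ = ρ := cfc_id' ℝ ρ hρ.1.isSelfAdjoint
  have o0 : cfc (fun _ : ℝ => (1 : ℝ)) ρ₀ = 1 := cfc_const_one ℝ ρ₀ hρ₀.1.isSelfAdjoint
  have o1 : cfc (fun _ : ℝ => (1 : ℝ)) ρ = 1 := cfc_const_one ℝ ρ hρ.1.isSelfAdjoint
  have t1 : ∑ i, ∑ j, w i j * (r j - σ i) = 0 := by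
    have h1 := T (fun _ => 1) (fun x => x)
    have h2 := T (fun x => x) (fun _ => 1)
    rw [o0, i1, Matrix.one_mul, htr] at h1
    rw [o1, i0, Matrix.mul_one, htr₀] at h2
    simp only [one_mul, mul_one] at h1 h2
    simp only [mul_sub, Finset.sum_sub_distrib]
    rw [← h1, ← h2, sub_self]
  have t2 : vonNeumannEntropy ρ + (ρ * cfc Real.log ρ₀).trace.re =
      -∑ i, ∑ j, w i j * (r j * (Real.log (r j) - Real.log (σ i)) - (r j - σ i)) := by
    have h1 := re_trace_mul_log_sub hρ.1 hρ₀.1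
    have h2 : vonNeumannEntropy ρ = -(ρ * cfc Real.log ρ).trace.re := rfl
    simp only [mul_sub (w _ _) (_ * _), Finset.sum_sub_distrib, t1, sub_zero]
    rw [← h1, h2]
    ring
  have t3 : (ρ * kerProj ρ₀).trace.re = ∑ i, ∑ j, w i j * ((if σ i = 0 then 1 else 0) * r j) := by
    rw [trace_mul_comm, kerProj, ← T (fun x => if x = 0 then 1 else 0) (fun x => x), i1]
  have t4 : (Fintype.card n : ℝ) = ∑ i, ∑ j, w i j := by
    have h := T (fun _ => 1) (fun _ => 1)
    rw [o0, o1, Matrix.mul_one, trace_one] at h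
    simpa using h
  have t5 : ((ρ - ρ₀) * (ρ - ρ₀)).trace.re = ∑ i, ∑ j, w i j * (r j - σ i) ^ 2 := by
    have h1 := T (fun _ => 1) (fun x => x * x)
    have h2 := T (fun x => x * x) (fun _ => 1)
    have h3 := T (fun x => x) (fun x => x)
    rw [← hρ.1.mul_cfc, i1, o0, Matrix.one_mul] at h1
    rw [← hρ₀.1.mul_cfc, i0, o1, Matrix.mul_one] at h2
    rw [i0, i1] at h3
    have : ((ρ - ρ₀) * (ρ - ρ₀)).trace.re =
        (ρ * ρ).trace.re - 2 * (ρ₀ * ρ).trace.re + (ρ₀ * ρ₀).trace.re := by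
      rw [Matrix.sub_mul, Matrix.mul_sub, Matrix.mul_sub, trace_sub, trace_sub, trace_sub,
        trace_mul_comm ρ ρ₀]
      simp only [Complex.sub_re]
      ring
    rw [this, h1, h2, h3, Finset.mul_sum, ← Finset.sum_sub_distrib, ← Finset.sum_add_distrib]
    refine Finset.sum_congr rfl fun i _ => ?_
    rw [Finset.mul_sum, ← Finset.sum_sub_distrib, ← Finset.sum_add_distrib]
    refine Finset.sum_congr rfl fun j _ => ?_
    ring
  rw [t2, t3, t4, t5, abs_neg, Finset.sum_mul, Finset.sum_mul, Finset.mul_sum,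
    ← Finset.sum_add_distrib, ← Finset.sum_add_distrib]
  refine (Finset.abs_sum_le_sum_abs _ _).trans (Finset.sum_le_sum fun i _ => ?_)
  rw [Finset.sum_mul, Finset.sum_mul, Finset.mul_sum, ← Finset.sum_add_distrib,
    ← Finset.sum_add_distrib]
  refine (Finset.abs_sum_le_sum_abs _ _).trans (Finset.sum_le_sum fun j _ => ?_)
  have hwij : 0 ≤ w i j := by positivity
  rw [abs_mul, abs_of_nonneg hwij]
  -- `Real.log 0 = 0` is the convention that makes `K_X` vanish on the kernel of `ρ₀`.
  have key : |r j * (Real.log (r j) - Real.log (σ i)) - (r j - σ i)| ≤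
      (if σ i = 0 then 1 else 0) * r j * (1 - Real.log s) + s + C * (r j - σ i) ^ 2 := by
    have hsq : 0 ≤ (r j - σ i) ^ 2 := sq_nonneg _
    rcases (hs₀ i).eq_or_lt with h0 | h0
    · have h := abs_mul_log_le (hr j) (hr1 j) hs
      rw [← h0] at hsq ⊢
      rw [if_pos rfl, Real.log_zero, sub_zero, sub_zero]
      rw [sub_zero] at hsq
      have h' := abs_sub (r j * Real.log (r j)) (r j)
      rw [abs_of_nonneg (hr j)] at h'
      nlinarith [mul_nonneg hC0 hsq]
    · rw [if_neg h0.ne']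
      have h := abs_mul_log_sub_log_sub_le (hr j) h0
      nlinarith [mul_le_mul_of_nonneg_right (hCi i) hsq]
  refine (mul_le_mul_of_nonneg_left key hwij).trans (le_of_eq ?_)
  ring

end Matrix

/-! ### First law of entanglement -/

section Expectation

variable {ι : Type*} [Fintype ι] [DecidableEq ι]

theorem hasDerivAt_toEuclideanLin (N : Matrix ι ι ℂ) {γ : ℝ → EuclideanSpace ℂ ι}
    {Φ : EuclideanSpace ℂ ι} {t : ℝ} (hγ : HasDerivAt γ Φ t) :
    HasDerivAt (fun ε => toEuclideanLin N (γ ε)) (toEuclideanLin N Φ) t :=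
  (((toEuclideanLin N).toContinuousLinearMap).restrictScalars ℝ).hasFDerivAt.comp_hasDerivAt t hγ

theorem hasDerivAt_inner_toEuclideanLin (N : Matrix ι ι ℂ) {γ : ℝ → EuclideanSpace ℂ ι}
    {Φ : EuclideanSpace ℂ ι} {t : ℝ} (hγ : HasDerivAt γ Φ t) :
    HasDerivAt (fun ε => ⟪γ ε, toEuclideanLin N (γ ε)⟫_ℂ)
      (⟪γ t, toEuclideanLin N Φ⟫_ℂ + ⟪Φ, toEuclideanLin N (γ t)⟫_ℂ) t :=
  hγ.inner ℂ (hasDerivAt_toEuclideanLin N hγ)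

theorem inner_toEuclideanLin_left {N : Matrix ι ι ℂ} (hN : N.IsHermitian)
    (x y : EuclideanSpace ℂ ι) :
    ⟪toEuclideanLin N x, y⟫_ℂ = ⟪x, toEuclideanLin N y⟫_ℂ :=
  isSymmetric_toEuclideanLin_iff.2 hN x y

theorem hasDerivAt_re_inner_toEuclideanLin {N : Matrix ι ι ℂ} (hN : N.IsHermitian)
    {γ : ℝ → EuclideanSpace ℂ ι} {Φ : EuclideanSpace ℂ ι} {t : ℝ} (hγ : HasDerivAt γ Φ t) :
    HasDerivAt (fun ε => (⟪γ ε, toEuclideanLin N (γ ε)⟫_ℂ).re)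
      (2 * (⟪Φ, toEuclideanLin N (γ t)⟫_ℂ).re) t := by
  refine (Complex.reCLM.hasFDerivAt.comp_hasDerivAt t
    (hasDerivAt_inner_toEuclideanLin N hγ)).congr_deriv ?_
  have h : (⟪toEuclideanLin N (γ t), Φ⟫_ℂ).re = (⟪Φ, toEuclideanLin N (γ t)⟫_ℂ).re := by
    rw [← inner_conj_symm, Complex.conj_re]
  rw [← inner_toEuclideanLin_left hN]
  simp [h, two_mul]

end Expectation

section EntropyDerivative

variable {Λ : Type*} [Fintype Λ] [DecidableEq Λ] {d : Λ → Type*} [∀ i, Fintype (d i)]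
  [∀ i, DecidableEq (d i)]

theorem trace_pureDensity_mul (ψ : StateSpace d) (N : Matrix (∀ i, d i) (∀ i, d i) ℂ) :
    (pureDensity ψ * N).trace = ⟪ψ, toEuclideanLin N ψ⟫_ℂ := by
  simp only [trace, diag_apply, mul_apply, pureDensity, vecMulVec_apply, PiLp.inner_apply,
    toLpLin_apply, mulVec, dotProduct, RCLike.inner_apply, Finset.sum_mul, Pi.star_apply]
  rw [Finset.sum_comm]
  refine Finset.sum_congr rfl fun i _ => Finset.sum_congr rfl fun j _ => ?_
  simp only [Complex.star_def]
  ring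

theorem trace_reducedDensity_mul (X : Finset Λ) (ψ : StateSpace d)
    (N : Matrix (RegionConfig d X) (RegionConfig d X) ℂ) :
    (reducedDensity X ψ * N).trace =
      ⟪ψ, toEuclideanLin (tensorEmbed (regionFactor d X) N) ψ⟫_ℂ := by
  rw [reducedDensity_eq_partialTrace, ← trace_mul_tensorEmbed, trace_pureDensity_mul]

theorem trace_reducedDensity (X : Finset Λ) (ψ : StateSpace d) :
    (reducedDensity X ψ).trace = (‖ψ‖ ^ 2 : ℝ) := by
  have h := trace_reducedDensity_mul X ψ 1
  rw [Matrix.mul_one, map_one] at h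
  rw [h]
  simp [inner_self_eq_norm_sq_to_K]

theorem globalModularHamiltonian_eq_tensorEmbed (X : Finset Λ) (ψ : StateSpace d) :
    globalModularHamiltonian X ψ = tensorEmbed (regionFactor d X) (modularHamiltonian X ψ) := by
  ext x y
  rw [tensorEmbed_apply, globalModularHamiltonian, submatrix_apply, kroneckerMap_apply, one_apply,
    mul_ite, mul_one, mul_zero]
  rfl

theorem tensorEmbed_isHermitian {e k m : Type*} [Fintype m] [DecidableEq m] [Fintype e]
    [DecidableEq e] [Fintype k] [DecidableEq k] (f : e ≃ k × m) {N : Matrix m m ℂ}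
    (hN : N.IsHermitian) : (tensorEmbed f N).IsHermitian := by
  rw [IsHermitian, ← star_eq_conjTranspose, ← map_star, star_eq_conjTranspose, hN.eq]

theorem globalModularHamiltonian_isHermitian (X : Finset Λ) (ψ : StateSpace d) :
    (globalModularHamiltonian X ψ).IsHermitian := by
  rw [globalModularHamiltonian_eq_tensorEmbed]
  exact tensorEmbed_isHermitian _ (isHermitian_cfc _ _).neg

/-- The weight of a perturbed state on the kernel of `ρ_X` is of second order, because the
projection onto this kernel annihilates the unperturbed state. -/
theorem isBigO_trace_mul_kerProj (X : Finset Λ) {γ : ℝ → StateSpace d} {Φ : StateSpace d}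
    (hγ : HasDerivAt γ Φ 0) :
    (fun ε => (reducedDensity X (γ ε) * kerProj (reducedDensity X (γ 0))).trace.re) =O[𝓝 0]
      fun ε => ε ^ 2 := by
  set P := tensorEmbed (regionFactor d X) (kerProj (reducedDensity X (γ 0))) with hP
  have hPP : P * P = P := by rw [hP, ← map_mul, kerProj_mul_self]
  have hPh : P.IsHermitian := tensorEmbed_isHermitian _ (isHermitian_cfc _ _)
  have hnorm : ∀ ψ : StateSpace d,
      (reducedDensity X ψ * kerProj (reducedDensity X (γ 0))).trace =
        (‖toEuclideanLin P ψ‖ ^ 2 : ℝ) := by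
    intro ψ
    have h := inner_self_eq_norm_sq_to_K (𝕜 := ℂ) (toEuclideanLin P ψ)
    have h2 : toEuclideanLin P (toEuclideanLin P ψ) = toEuclideanLin P ψ := by
      conv_rhs => rw [← hPP]
      simp [toLpLin_apply, mulVec_mulVec]
    rw [inner_toEuclideanLin_left hPh, h2] at h
    rw [trace_reducedDensity_mul, ← hP, h]
    simp
  have h0 : toEuclideanLin P (γ 0) = 0 := by
    have h := hnorm (γ 0)
    rw [(reducedDensity_posSemidef X (γ 0)).1.mul_kerProj, trace_zero] at h
    have h' : ‖toEuclideanLin P (γ 0)‖ ^ 2 = 0 := by exact_mod_cast h.symm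
    simpa using h'
  have h1 := (hasDerivAt_toEuclideanLin P hγ).isBigO_sub
  simp only [h0, sub_zero] at h1
  simp only [hnorm, Complex.ofReal_re]
  exact h1.norm_left.pow 2

/-- The Hilbert-Schmidt distance of the reduced density matrices is of first order. -/
theorem isBigO_trace_sub_mul_sub (X : Finset Λ) {γ : ℝ → StateSpace d} {Φ : StateSpace d}
    (hγ : HasDerivAt γ Φ 0) :
    (fun ε => ((reducedDensity X (γ ε) - reducedDensity X (γ 0)) *
      (reducedDensity X (γ ε) - reducedDensity X (γ 0))).trace.re) =O[𝓝 0] fun ε => ε ^ 2 := by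
  have hent : ∀ s t, (fun ε => (reducedDensity X (γ ε) - reducedDensity X (γ 0)) s t) =O[𝓝 0]
      fun ε => ε := by
    intro s t
    have h : ∀ ψ : StateSpace d, reducedDensity X ψ s t =
        ⟪ψ, toEuclideanLin (tensorEmbed (regionFactor d X) (single t s 1)) ψ⟫_ℂ := by
      intro ψ
      rw [← trace_reducedDensity_mul, trace_mul_single]
      simp
    have := (hasDerivAt_inner_toEuclideanLin
      (tensorEmbed (regionFactor d X) (single t s 1)) hγ).isBigO_sub
    simpa only [Matrix.sub_apply, h, sub_zero] using this
  have hre : ∀ (f : ℝ → ℂ), f =O[𝓝 0] (fun ε : ℝ => ε ^ 2) →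
      (fun ε => (f ε).re) =O[𝓝 0] fun ε : ℝ => ε ^ 2 := fun f hf =>
    (IsBigO.of_bound 1 (Eventually.of_forall fun ε => by
      simpa using Complex.abs_re_le_norm (f ε))).trans hf
  refine hre _ ?_
  simp only [trace, diag_apply, mul_apply]
  refine IsBigO.fun_sum fun s _ => IsBigO.fun_sum fun t _ => ?_
  simpa only [sq] using (hent s t).mul (hent t s)

/-- The first law of entanglement: the first-order variation of `S_X` is that of the expectation
value of the fixed operator `K_X`. -/
theorem hasDerivAt_entropy (X : Finset Λ) {γ : ℝ → StateSpace d} {Φ : StateSpace d}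
    (hγ : HasDerivAt γ Φ 0) (hnorm : ∀ ε, ‖γ ε‖ = 1) :
    HasDerivAt (fun ε => entropy X (γ ε))
      (2 * (⟪Φ, toEuclideanLin (globalModularHamiltonian X (γ 0)) (γ 0)⟫_ℂ).re) 0 := by
  set ρ₀ := reducedDensity X (γ 0) with hρ₀
  have htr : ∀ ε, (reducedDensity X (γ ε)).trace = 1 := fun ε => by
    rw [trace_reducedDensity, hnorm]
    simp
  obtain ⟨C, hC0, hC⟩ := (reducedDensity_posSemidef X (γ 0)).exists_abs_vonNeumannEntropy_add_le
  set h : ℝ → ℝ := fun ε => vonNeumannEntropy (reducedDensity X (γ ε)) +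
    (reducedDensity X (γ ε) * cfc Real.log ρ₀).trace.re with hh
  have hsum : ∀ ε, entropy X (γ ε) = h ε +
      (⟪γ ε, toEuclideanLin (globalModularHamiltonian X (γ 0)) (γ ε)⟫_ℂ).re := by
    intro ε
    rw [globalModularHamiltonian_eq_tensorEmbed, ← trace_reducedDensity_mul, modularHamiltonian,
      Matrix.mul_neg, trace_neg, Complex.neg_re, entropy_eq_vonNeumannEntropy]
    simp [hh, hρ₀]
  have h0 : h 0 = 0 := by
    simp only [hh, vonNeumannEntropy, ← hρ₀]
    ring
  -- The remainder is bounded with the regularization scale `s = ε ^ 2`.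
  have hlog : Tendsto (fun ε : ℝ => ε * (1 - Real.log (ε ^ 2))) (𝓝 0) (𝓝 0) := by
    have : Continuous fun ε : ℝ => ε - 2 * (ε * Real.log ε) :=
      continuous_id.sub (continuous_const.mul Real.continuous_mul_log)
    have h2 := this.tendsto 0
    simp only [zero_mul, mul_zero, sub_zero] at h2
    refine h2.congr fun ε => ?_
    rw [Real.log_pow]
    push_cast
    ring
  have hlog' : (fun ε : ℝ => ε * (1 - Real.log (ε ^ 2))) =o[𝓝 0] fun _ => (1 : ℝ) :=
    (isLittleO_one_iff ℝ).2 hlog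
  have hid : (fun ε : ℝ => ε) =o[𝓝 0] fun _ => (1 : ℝ) := (isLittleO_one_iff ℝ).2 tendsto_id
  have hsq : (fun ε : ℝ => ε ^ 2) =o[𝓝 0] fun ε => ε := by
    simpa only [sq, mul_one] using (isBigO_refl (fun ε : ℝ => ε) (𝓝 0)).mul_isLittleO hid
  have hbound : (fun ε => (reducedDensity X (γ ε) * kerProj ρ₀).trace.re *
        (1 - Real.log (ε ^ 2)) + Fintype.card (RegionConfig d X) * ε ^ 2 +
          C * ((reducedDensity X (γ ε) - ρ₀) * (reducedDensity X (γ ε) - ρ₀)).trace.re) =o[𝓝 0]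
      fun ε => ε := by
    refine (IsLittleO.add ?_ (hsq.const_mul_left _)).add
      (((isBigO_trace_sub_mul_sub X hγ).trans_isLittleO hsq).const_mul_left C)
    refine ((isBigO_trace_mul_kerProj X hγ).mul
      (isBigO_refl (fun ε : ℝ => 1 - Real.log (ε ^ 2)) (𝓝 0))).trans_isLittleO ?_
    simpa only [sq, mul_one, mul_assoc] using
      (isBigO_refl (fun ε : ℝ => ε) (𝓝 0)).mul_isLittleO hlog'
  have hder : HasDerivAt h 0 0 := by
    rw [hasDerivAt_iff_isLittleO]
    simp only [h0, sub_zero, smul_zero]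
    refine IsBigO.trans_isLittleO (IsBigO.of_bound 1 (Eventually.of_forall fun ε => ?_)) hbound
    rw [one_mul]
    rcases eq_or_ne ε 0 with rfl | hε
    · simp [h0]
    · exact (hC _ (reducedDensity_posSemidef X _) (htr ε) (htr 0) (ε ^ 2) (by positivity)).trans
        (le_abs_self _)
  have := hder.add (hasDerivAt_re_inner_toEuclideanLin
    (globalModularHamiltonian_isHermitian X (γ 0)) hγ)
  rw [zero_add] at this
  exact this.congr_of_eventuallyEq (Eventually.of_forall hsum)

end EntropyDerivative

/-! ### Central charge and its variation -/

section CentralCharge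

theorem centralCharge_nonneg (Δ I : ℝ) : 0 ≤ centralCharge Δ I := by
  unfold centralCharge
  split_ifs with h
  · exact h.choose_spec.1.le
  · exact le_rfl

/-- A linear bound on the central charge: one of the two exponentials is at most `1 / 2`. -/
theorem centralCharge_le {Δ I : ℝ} (hΔ : 0 ≤ Δ) (hI : 0 ≤ I) :
    centralCharge Δ I ≤ 6 / Real.log 2 * (Δ + I) := by
  have hlog : 0 < Real.log 2 := Real.log_pos one_lt_two
  rcases hΔ.eq_or_lt with h | hΔ'
  · rw [centralCharge_eq_zero (Or.inl h.symm)]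
    positivity
  rcases hI.eq_or_lt with h | hI'
  · rw [centralCharge_eq_zero (Or.inr h.symm)]
    positivity
  obtain ⟨hc, he⟩ := (centralCharge_spec hΔ' hI' _).2 rfl
  set c := centralCharge Δ I
  have key : ∀ x : ℝ, Real.exp (-6 * x / c) ≤ 1 / 2 → c * Real.log 2 ≤ 6 * x := by
    intro x hx
    have h := Real.log_le_log (Real.exp_pos _) hx
    rw [Real.log_exp, one_div, Real.log_inv, div_le_iff₀ hc] at h
    linarith
  rw [div_mul_eq_mul_div, le_div_iff₀ hlog]
  rcases le_total (Real.exp (-6 * Δ / c)) (1 / 2) with h | h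
  · linarith [key Δ h]
  · linarith [key I (by linarith)]

/-- The implicit function theorem applies, since the left-hand side of `e^{-6Δ/c} + e^{-6I/c} = 1` has
positive derivative in `c`. -/
theorem differentiableAt_centralCharge {Δ I : ℝ} (hΔ : 0 < Δ) (hI : 0 < I) :
    DifferentiableAt ℝ (fun x : ℝ × ℝ => centralCharge x.1 x.2) (Δ, I) := by
  obtain ⟨hc, he⟩ := (centralCharge_spec hΔ hI _).2 rfl
  set c := centralCharge Δ I with hcdef
  set f : (ℝ × ℝ) × ℝ → ℝ := fun p =>
    Real.exp (-6 * p.1.1 / p.2) + Real.exp (-6 * p.1.2 / p.2) with hf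
  have hfc : ContDiffAt ℝ 1 f ((Δ, I), c) := by
    have h1 : ContDiffAt ℝ 1 (fun p : (ℝ × ℝ) × ℝ => -6 * p.1.1 / p.2) ((Δ, I), c) :=
      ContDiffAt.div (by fun_prop) (by fun_prop) hc.ne'
    have h2 : ContDiffAt ℝ 1 (fun p : (ℝ × ℝ) × ℝ => -6 * p.1.2 / p.2) ((Δ, I), c) :=
      ContDiffAt.div (by fun_prop) (by fun_prop) hc.ne'
    exact h1.exp.add h2.exp
  have hstrict := hfc.hasStrictFDerivAt one_ne_zero
  have hder : HasDerivAt (fun y => f ((Δ, I), y)) (fderiv ℝ f ((Δ, I), c) (0, 1)) c :=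
    hstrict.hasFDerivAt.comp_hasDerivAt c ((hasDerivAt_const c (Δ, I)).prodMk (hasDerivAt_id c))
  have hder' : HasDerivAt (fun y => f ((Δ, I), y))
      (Real.exp (-6 * Δ / c) * (6 * Δ / c ^ 2) + Real.exp (-6 * I / c) * (6 * I / c ^ 2)) c := by
    have h : ∀ x : ℝ, HasDerivAt (fun y : ℝ => Real.exp (-6 * x / y))
        (Real.exp (-6 * x / c) * (6 * x / c ^ 2)) c := by
      intro x
      refine (((hasDerivAt_const c (-6 * x)).div (hasDerivAt_id c) hc.ne').exp).congr_deriv ?_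
      simp
    exact (h Δ).add (h I)
  have hne : fderiv ℝ f ((Δ, I), c) (0, 1) ≠ 0 := by
    rw [hder.unique hder']
    positivity
  have hinv : (fderiv ℝ f ((Δ, I), c) ∘L .inr ℝ (ℝ × ℝ) ℝ).IsInvertible := by
    refine ⟨ContinuousLinearEquiv.unitsEquivAut ℝ (Units.mk0 _ hne), ?_⟩
    ext
    simp
  have hu : f ((Δ, I), c) = 1 := he
  have h1 := hstrict.hasStrictFDerivAt_implicitFunctionOfProdDomain hinv
  have h2 := hstrict.tendsto_implicitFunctionOfProdDomain hinv
  have h3 := hstrict.eventually_apply_implicitFunctionOfProdDomain hinv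
  refine h1.hasFDerivAt.differentiableAt.congr_of_eventuallyEq ?_
  have hx1 : ∀ᶠ x : ℝ × ℝ in 𝓝 (Δ, I), 0 < x.1 :=
    (continuous_fst.tendsto (Δ, I)).eventually (lt_mem_nhds hΔ)
  have hx2 : ∀ᶠ x : ℝ × ℝ in 𝓝 (Δ, I), 0 < x.2 :=
    (continuous_snd.tendsto (Δ, I)).eventually (lt_mem_nhds hI)
  filter_upwards [h2.eventually (lt_mem_nhds hc), h3, hx1, hx2] with x hx hx' hx1 hx2
  exact ((centralCharge_spec hx1 hx2 _).1 ⟨hx, hx'.trans hu⟩).symm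

/-- Implicit differentiation of `e^{-6Δ/c} + e^{-6I/c} = 1`: with `η = e^{-6Δ/c}`, the variation of
`c` is a positive multiple of `η Δ' + (1 - η) I'`. -/
theorem exists_hasDerivAt_centralCharge {Δ I : ℝ} (hΔ : 0 < Δ) (hI : 0 < I) :
    ∃ κ : ℝ, 0 < κ ∧ ∀ (f g : ℝ → ℝ) (f' g' : ℝ), f 0 = Δ → g 0 = I → HasDerivAt f f' 0 →
      HasDerivAt g g' 0 → HasDerivAt (fun ε => centralCharge (f ε) (g ε))
        (κ * (Real.exp (-6 * Δ / centralCharge Δ I) * f' +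
          (1 - Real.exp (-6 * Δ / centralCharge Δ I)) * g')) 0 := by
  obtain ⟨hc, he⟩ := (centralCharge_spec hΔ hI _).2 rfl
  set c := centralCharge Δ I with hcdef
  have hη := Real.exp_pos (-6 * Δ / c)
  have hη' := Real.exp_pos (-6 * I / c)
  have hpos : 0 < Real.exp (-6 * Δ / c) * Δ + Real.exp (-6 * I / c) * I := by positivity
  refine ⟨c / (Real.exp (-6 * Δ / c) * Δ + Real.exp (-6 * I / c) * I), by positivity, ?_⟩
  rintro f g f' g' rfl rfl hf hg
  have hd : HasDerivAt (fun ε => centralCharge (f ε) (g ε))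
      (fderiv ℝ (fun x : ℝ × ℝ => centralCharge x.1 x.2) (f 0, g 0) (f', g')) 0 :=
    HasFDerivAt.comp_hasDerivAt (f := fun ε => (f ε, g ε)) 0
      (differentiableAt_centralCharge hΔ hI).hasFDerivAt (hf.prodMk hg)
  set c' := fderiv ℝ (fun x : ℝ × ℝ => centralCharge x.1 x.2) (f 0, g 0) (f', g')
  refine hd.congr_deriv ?_
  have hexp : ∀ (h : ℝ → ℝ) (h' : ℝ), HasDerivAt h h' 0 →
      HasDerivAt (fun ε => Real.exp (-6 * h ε / centralCharge (f ε) (g ε)))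
        (Real.exp (-6 * h 0 / c) * ((-6 * h' * c - -6 * h 0 * c') / c ^ 2)) 0 := fun h h' hh =>
    ((hh.const_mul (-6)).div hd hc.ne').exp
  have hsum := (hexp f f' hf).add (hexp g g' hg)
  have hone : (fun ε => Real.exp (-6 * f ε / centralCharge (f ε) (g ε)) +
      Real.exp (-6 * g ε / centralCharge (f ε) (g ε))) =ᶠ[𝓝 0] fun _ => 1 := by
    filter_upwards [hf.continuousAt.tendsto.eventually (lt_mem_nhds hΔ),
      hg.continuousAt.tendsto.eventually (lt_mem_nhds hI)] with ε h1 h2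
    exact ((centralCharge_spec h1 h2 _).2 rfl).2
  have hzero := (hsum.congr_of_eventuallyEq hone.symm).unique (hasDerivAt_const 0 1)
  have h1 : 1 - Real.exp (-6 * f 0 / c) = Real.exp (-6 * g 0 / c) := by linarith
  rw [h1]
  set η := Real.exp (-6 * f 0 / c)
  set θ := Real.exp (-6 * g 0 / c)
  rw [div_mul_eq_mul_div, eq_div_iff hpos.ne']
  field_simp at hzero
  nlinarith

end CentralCharge

section Tangent

variable {ι : Type*} [Fintype ι]

/-- Every unit vector orthogonal to `Ψ` is the velocity of a great circle through `Ψ`. -/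
theorem exists_hasDerivAt_unit_of_inner_eq_zero {Ψ Φ : EuclideanSpace ℂ ι} (hΨ : ‖Ψ‖ = 1)
    (hΦ : ‖Φ‖ = 1) (h : ⟪Ψ, Φ⟫_ℂ = 0) :
    ∃ γ : ℝ → EuclideanSpace ℂ ι, γ 0 = Ψ ∧ (∀ ε, ‖γ ε‖ = 1) ∧ HasDerivAt γ Φ 0 := by
  refine ⟨fun ε => Real.cos ε • Ψ + Real.sin ε • Φ, by simp, fun ε => ?_, ?_⟩
  · have h0 : ⟪Real.cos ε • Ψ, Real.sin ε • Φ⟫_ℂ = 0 := by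
      rw [inner_smul_left_eq_smul, inner_smul_right_eq_smul, h]
      simp
    have h1 := norm_add_sq_eq_norm_sq_add_norm_sq_of_inner_eq_zero _ _ h0
    rw [norm_smul, norm_smul, hΨ, hΦ, mul_one, mul_one, Real.norm_eq_abs, Real.norm_eq_abs,
      abs_mul_abs_self, abs_mul_abs_self, ← sq, ← sq, ← sq, Real.cos_sq_add_sin_sq] at h1
    exact (pow_eq_one_iff_of_nonneg (norm_nonneg _) two_ne_zero).1 h1
  · exact (((Real.hasDerivAt_cos 0).smul_const Ψ).add
      ((Real.hasDerivAt_sin 0).smul_const Φ)).congr_deriv (by simp)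

variable [DecidableEq ι]

/-- A tangent vector to the unit sphere is real-orthogonal to the base point. -/
theorem re_inner_eq_zero_of_hasDerivAt {γ : ℝ → EuclideanSpace ℂ ι} {Φ : EuclideanSpace ℂ ι}
    (hγ : HasDerivAt γ Φ 0) (hnorm : ∀ ε, ‖γ ε‖ = 1) : (⟪Φ, γ 0⟫_ℂ).re = 0 := by
  have h := hasDerivAt_re_inner_toEuclideanLin (isHermitian_one (n := ι) (α := ℂ)) hγ
  have h1 : ∀ x : EuclideanSpace ℂ ι, toEuclideanLin (1 : Matrix ι ι ℂ) x = x := fun x => by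
    simp
  simp only [h1] at h
  have h2 : (fun ε => (⟪γ ε, γ ε⟫_ℂ).re) = fun _ => (1 : ℝ) := by
    funext ε
    rw [inner_self_eq_norm_sq_to_K, hnorm]
    simp
  rw [h2] at h
  linarith [h.unique (hasDerivAt_const 0 1)]

/-- The expectation value of `N` has no first-order variation on the unit sphere at `Ψ` exactly when
`Ψ` is an eigenvector of `N`. -/
theorem forall_re_inner_eq_zero_iff_exists_eq_smul {N : Matrix ι ι ℂ} (hN : N.IsHermitian)
    {Ψ : EuclideanSpace ℂ ι} (hΨ : ‖Ψ‖ = 1) :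
    (∀ (γ : ℝ → EuclideanSpace ℂ ι) (Φ : EuclideanSpace ℂ ι), γ 0 = Ψ → (∀ ε, ‖γ ε‖ = 1) →
      HasDerivAt γ Φ 0 → (⟪Φ, toEuclideanLin N Ψ⟫_ℂ).re = 0) ↔
    ∃ a : ℂ, toEuclideanLin N Ψ = a • Ψ := by
  have hΨΨ : ⟪Ψ, Ψ⟫_ℂ = 1 := by
    rw [inner_self_eq_norm_sq_to_K, hΨ]
    simp
  constructor
  · intro h
    set a := ⟪Ψ, toEuclideanLin N Ψ⟫_ℂ with ha
    refine ⟨a, ?_⟩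
    set Φ := toEuclideanLin N Ψ - a • Ψ with hΦ
    have horth : ⟪Ψ, Φ⟫_ℂ = 0 := by
      rw [hΦ, inner_sub_right, inner_smul_right, hΨΨ, ← ha]
      ring
    by_contra hne
    have hΦ0 : Φ ≠ 0 := sub_ne_zero.2 hne
    have hnorm : ‖Φ‖ ≠ 0 := norm_ne_zero_iff.2 hΦ0
    obtain ⟨γ, h1, h2, h3⟩ := exists_hasDerivAt_unit_of_inner_eq_zero (Φ := (‖Φ‖⁻¹ : ℝ) • Φ) hΨ
      (by rw [norm_smul, norm_inv, norm_norm, inv_mul_cancel₀ hnorm])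
      (by rw [inner_smul_right_eq_smul, horth, smul_zero])
    have h4 := h γ _ h1 h2 h3
    have h5 : toEuclideanLin N Ψ = Φ + a • Ψ := by rw [hΦ, sub_add_cancel]
    have h6 : ⟪Φ, Ψ⟫_ℂ = 0 := by rw [← inner_conj_symm, horth, map_zero]
    rw [inner_smul_left_eq_smul, h5, inner_add_right, inner_smul_right, h6, mul_zero, add_zero,
      inner_self_eq_norm_sq_to_K] at h4
    have h7 : ‖Φ‖⁻¹ * ‖Φ‖ ^ 2 = 0 := by
      rw [← h4]
      simp [← Complex.ofReal_pow]
    have h8 : ‖Φ‖⁻¹ * ‖Φ‖ ^ 2 = ‖Φ‖ := by field_simp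
    exact hnorm (h8 ▸ h7)
  · rintro ⟨a, ha⟩ γ Φ rfl hnorm hγ
    have him : a.im = 0 := by
      have h1 : ⟪γ 0, toEuclideanLin N (γ 0)⟫_ℂ = a := by
        rw [ha, inner_smul_right, hΨΨ, mul_one]
      have h2 : conj a = a := by
        conv_lhs => rw [← h1]
        rw [inner_conj_symm, inner_toEuclideanLin_left hN, h1]
      exact Complex.conj_eq_iff_im.1 h2
    rw [ha, inner_smul_right, Complex.mul_re, him, zero_mul, sub_zero,
      re_inner_eq_zero_of_hasDerivAt hγ hnorm, mul_zero]

end Tangent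

section RulerVariation

variable {Λ : Type*} [Fintype Λ] [DecidableEq Λ] {d : Λ → Type*} [∀ i, Fintype (d i)]
  [∀ i, DecidableEq (d i)]

namespace Ruler

theorem deltaOp_isHermitian (D : Ruler Λ) (ψ : StateSpace d) : (D.deltaOp ψ).IsHermitian :=
  (((globalModularHamiltonian_isHermitian _ ψ).add (globalModularHamiltonian_isHermitian _ ψ)).sub
    (globalModularHamiltonian_isHermitian _ ψ)).sub (globalModularHamiltonian_isHermitian _ ψ)

theorem infoOp_isHermitian (D : Ruler Λ) (ψ : StateSpace d) : (D.infoOp ψ).IsHermitian :=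
  (((globalModularHamiltonian_isHermitian _ ψ).add (globalModularHamiltonian_isHermitian _ ψ)).sub
    (globalModularHamiltonian_isHermitian _ ψ)).sub (globalModularHamiltonian_isHermitian _ ψ)

theorem fixedPointOp_isHermitian (D : Ruler Λ) (ψ : StateSpace d) (x : ℝ) :
    (D.fixedPointOp ψ x).IsHermitian := by
  have h : ∀ (r : ℝ) (N : Matrix (∀ i, d i) (∀ i, d i) ℂ), N.IsHermitian →
      ((r : ℂ) • N).IsHermitian := by
    intro r N hN
    rw [IsHermitian, conjTranspose_smul, hN.eq, Complex.star_def, Complex.conj_ofReal]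
  have h2 := (h x _ (D.deltaOp_isHermitian ψ)).add (h (1 - x) _ (D.infoOp_isHermitian ψ))
  rwa [Complex.ofReal_sub, Complex.ofReal_one] at h2

theorem re_inner_fixedPointOp (D : Ruler Λ) (ψ Φ : StateSpace d) (x : ℝ) :
    (⟪Φ, toEuclideanLin (D.fixedPointOp ψ x) ψ⟫_ℂ).re =
      x * (⟪Φ, toEuclideanLin (D.deltaOp ψ) ψ⟫_ℂ).re +
        (1 - x) * (⟪Φ, toEuclideanLin (D.infoOp ψ) ψ⟫_ℂ).re := by
  rw [fixedPointOp, map_add, map_smul, map_smul, LinearMap.add_apply, LinearMap.smul_apply,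
    LinearMap.smul_apply, inner_add_right, inner_smul_right, inner_smul_right, Complex.add_re,
    ← Complex.ofReal_one, ← Complex.ofReal_sub, Complex.re_ofReal_mul, Complex.re_ofReal_mul]

theorem hasDerivAt_delta (D : Ruler Λ) {γ : ℝ → StateSpace d} {Φ : StateSpace d}
    (hγ : HasDerivAt γ Φ 0) (hnorm : ∀ ε, ‖γ ε‖ = 1) :
    HasDerivAt (fun ε => D.delta (γ ε))
      (2 * (⟪Φ, toEuclideanLin (D.deltaOp (γ 0)) (γ 0)⟫_ℂ).re) 0 := by
  refine ((((hasDerivAt_entropy _ hγ hnorm).add (hasDerivAt_entropy _ hγ hnorm)).sub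
    (hasDerivAt_entropy _ hγ hnorm)).sub (hasDerivAt_entropy _ hγ hnorm)).congr_deriv ?_
  simp only [deltaOp, map_add, map_sub, LinearMap.add_apply, LinearMap.sub_apply, inner_add_right,
    inner_sub_right, Complex.add_re, Complex.sub_re]
  ring

theorem hasDerivAt_info (D : Ruler Λ) {γ : ℝ → StateSpace d} {Φ : StateSpace d}
    (hγ : HasDerivAt γ Φ 0) (hnorm : ∀ ε, ‖γ ε‖ = 1) :
    HasDerivAt (fun ε => D.info (γ ε))
      (2 * (⟪Φ, toEuclideanLin (D.infoOp (γ 0)) (γ 0)⟫_ℂ).re) 0 := by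
  refine ((((hasDerivAt_entropy _ hγ hnorm).add (hasDerivAt_entropy _ hγ hnorm)).sub
    (hasDerivAt_entropy _ hγ hnorm)).sub (hasDerivAt_entropy _ hγ hnorm)).congr_deriv ?_
  simp only [infoOp, map_add, map_sub, LinearMap.add_apply, LinearMap.sub_apply, inner_add_right,
    inner_sub_right, Complex.add_re, Complex.sub_re]
  ring

/-- Where `Δ(𝔻)` attains its minimal value `0`, its first-order variation vanishes. -/
theorem re_inner_deltaOp_eq_zero [Nonempty (∀ i, d i)] (D : Ruler Λ) {γ : ℝ → StateSpace d}
    {Φ : StateSpace d} (hγ : HasDerivAt γ Φ 0) (hnorm : ∀ ε, ‖γ ε‖ = 1)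
    (h : D.delta (γ 0) = 0) : (⟪Φ, toEuclideanLin (D.deltaOp (γ 0)) (γ 0)⟫_ℂ).re = 0 := by
  have hmin : IsLocalMin (fun ε => D.delta (γ ε)) 0 :=
    Eventually.of_forall fun ε => by simpa only [h] using D.delta_nonneg (γ ε)
  linarith [hmin.hasDerivAt_eq_zero (D.hasDerivAt_delta hγ hnorm)]

theorem re_inner_infoOp_eq_zero [Nonempty (∀ i, d i)] (D : Ruler Λ) {γ : ℝ → StateSpace d}
    {Φ : StateSpace d} (hγ : HasDerivAt γ Φ 0) (hnorm : ∀ ε, ‖γ ε‖ = 1)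
    (h : D.info (γ 0) = 0) : (⟪Φ, toEuclideanLin (D.infoOp (γ 0)) (γ 0)⟫_ℂ).re = 0 := by
  have hmin : IsLocalMin (fun ε => D.info (γ ε)) 0 :=
    Eventually.of_forall fun ε => by simpa only [h] using D.info_nonneg (γ ε)
  linarith [hmin.hasDerivAt_eq_zero (D.hasDerivAt_info hγ hnorm)]

theorem ctot_nonneg (D : Ruler Λ) (ψ : StateSpace d) : 0 ≤ D.ctot ψ :=
  centralCharge_nonneg _ _

/-- Where `𝔠_tot` attains its minimal value `0`, it is stationary. -/
theorem isStationary_of_ctot_eq_zero (D : Ruler Λ) {Ψ : StateSpace d} (h : D.ctot Ψ = 0) :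
    D.IsStationary Ψ := by
  rintro γ ⟨h0, -, -⟩ δc hδ
  have hmin : IsLocalMin (fun ε => D.ctot (γ ε)) 0 :=
    Eventually.of_forall fun ε => by simpa only [h0, h] using D.ctot_nonneg (γ ε)
  exact hmin.hasDerivAt_eq_zero hδ

/-- If `Δ` and `I` both vanish, they are of order `o(ε)` along a perturbation, hence so is `𝔠_tot`. -/
theorem hasDerivAt_ctot_of_eq_zero [Nonempty (∀ i, d i)] (D : Ruler Λ) {γ : ℝ → StateSpace d}
    {Φ : StateSpace d} (hγ : HasDerivAt γ Φ 0) (hnorm : ∀ ε, ‖γ ε‖ = 1)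
    (hΔ : D.delta (γ 0) = 0) (hI : D.info (γ 0) = 0) :
    HasDerivAt (fun ε => D.ctot (γ ε)) 0 0 := by
  have h1 := D.hasDerivAt_delta hγ hnorm
  have h2 := D.hasDerivAt_info hγ hnorm
  rw [D.re_inner_deltaOp_eq_zero hγ hnorm hΔ, mul_zero, hasDerivAt_iff_isLittleO] at h1
  rw [D.re_inner_infoOp_eq_zero hγ hnorm hI, mul_zero, hasDerivAt_iff_isLittleO] at h2
  rw [hasDerivAt_iff_isLittleO]
  have h0 : D.ctot (γ 0) = 0 := centralCharge_eq_zero (Or.inl hΔ)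
  simp only [hΔ, hI, h0, sub_zero, smul_zero] at h1 h2 ⊢
  refine IsBigO.trans_isLittleO (IsBigO.of_bound (6 / Real.log 2) (Eventually.of_forall fun ε => ?_))
    (h1.add h2)
  rw [Real.norm_of_nonneg (D.ctot_nonneg _),
    Real.norm_of_nonneg (add_nonneg (D.delta_nonneg _) (D.info_nonneg _))]
  exact centralCharge_le (D.delta_nonneg _) (D.info_nonneg _)

theorem exists_hasDerivAt_ctot (D : Ruler Λ) {Ψ : StateSpace d} (hΔ : 0 < D.delta Ψ)
    (hI : 0 < D.info Ψ) :
    ∃ κ : ℝ, 0 < κ ∧ ∀ (γ : ℝ → StateSpace d) (Φ : StateSpace d), γ 0 = Ψ → (∀ ε, ‖γ ε‖ = 1) →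
      HasDerivAt γ Φ 0 → HasDerivAt (fun ε => D.ctot (γ ε)) (κ * (⟪Φ, toEuclideanLin
        (D.fixedPointOp Ψ (Real.exp (-6 * D.delta Ψ / D.ctot Ψ))) Ψ⟫_ℂ).re) 0 := by
  obtain ⟨κ, hκ, h⟩ := exists_hasDerivAt_centralCharge hΔ hI
  refine ⟨2 * κ, by positivity, ?_⟩
  rintro γ Φ rfl hnorm hγ
  refine (h _ _ _ _ rfl rfl (D.hasDerivAt_delta hγ hnorm)
    (D.hasDerivAt_info hγ hnorm)).congr_deriv ?_
  rw [re_inner_fixedPointOp, ctot]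
  ring

end Ruler

end RulerVariation

end

/-! ### Stationarity and the vector fixed-point equation -/

/-- For every cross-ratio value `η`, stationarity of `𝔠_tot` is equivalent to the vector
fixed-point equation; and the first-order variation of `𝔠_tot` really exists along every
norm-preserving perturbation, except possibly when exactly one of `Δ` and `I` vanishes. -/
theorem theorem1 {Λ : Type*} [Fintype Λ] [DecidableEq Λ] {d : Λ → Type*} [∀ i, Fintype (d i)]
    [∀ i, DecidableEq (d i)] (D : Ruler Λ) (Ψ : StateSpace d) (hΨ : ‖Ψ‖ = 1) :
    (∀ η : ℝ, D.IsCrossRatio Ψ η → (D.IsStationary Ψ ↔ D.VectorFixedPoint Ψ η)) ∧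
    ((D.delta Ψ = 0 ↔ D.info Ψ = 0) → ∀ γ : ℝ → StateSpace d,
      IsNormPreservingPerturbation Ψ γ → DifferentiableAt ℝ (fun ε => D.ctot (γ ε)) 0) := by
  have hne : Nonempty (∀ i, d i) := by
    by_contra h
    rw [not_nonempty_iff] at h
    rw [Subsingleton.elim Ψ 0, norm_zero] at hΨ
    exact zero_ne_one hΨ
  have hΔ0 := D.delta_nonneg Ψ
  have hI0 := D.info_nonneg Ψ
  refine ⟨fun η hη => ?_, fun hiff γ hγ => ?_⟩
  · rw [Ruler.VectorFixedPoint,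
      ← forall_re_inner_eq_zero_iff_exists_eq_smul (D.fixedPointOp_isHermitian Ψ η) hΨ]
    rcases hη with ⟨hΔ, hI, rfl⟩ | ⟨hΔ, hI, rfl⟩ | ⟨hΔ, hI, rfl⟩ | ⟨hΔ, hI, -⟩
    · obtain ⟨κ, hκ, hder⟩ := D.exists_hasDerivAt_ctot (hΔ0.lt_of_ne' hΔ) (hI0.lt_of_ne' hI)
      constructor
      · intro hst γ Φ h0 hnorm hγ
        have := hst γ ⟨h0, fun ε => by rw [hnorm, hΨ], hγ.differentiableAt⟩ _
          (hder γ Φ h0 hnorm hγ)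
        exact (mul_eq_zero.1 this).resolve_left hκ.ne'
      · rintro h γ ⟨h0, hnorm, hγ⟩ δc hδ
        have hnorm' : ∀ ε, ‖γ ε‖ = 1 := fun ε => by rw [hnorm, hΨ]
        have := hδ.unique (hder γ _ h0 hnorm' hγ.hasDerivAt)
        rw [this, h γ _ h0 hnorm' hγ.hasDerivAt, mul_zero]
    -- In the degenerate cases both sides of the equivalence hold.
    · refine iff_of_true (D.isStationary_of_ctot_eq_zero (centralCharge_eq_zero (Or.inl hΔ))) ?_
      rintro γ Φ rfl hnorm hγ
      rw [D.re_inner_fixedPointOp, D.re_inner_deltaOp_eq_zero hγ hnorm hΔ]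
      ring
    · refine iff_of_true (D.isStationary_of_ctot_eq_zero (centralCharge_eq_zero (Or.inr hI))) ?_
      rintro γ Φ rfl hnorm hγ
      rw [D.re_inner_fixedPointOp, D.re_inner_infoOp_eq_zero hγ hnorm hI]
      ring
    · refine iff_of_true (D.isStationary_of_ctot_eq_zero (centralCharge_eq_zero (Or.inl hΔ))) ?_
      rintro γ Φ rfl hnorm hγ
      rw [D.re_inner_fixedPointOp, D.re_inner_deltaOp_eq_zero hγ hnorm hΔ,
        D.re_inner_infoOp_eq_zero hγ hnorm hI]
      ring
  · obtain ⟨h0, hnorm, hdiff⟩ := hγ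
    have hnorm' : ∀ ε, ‖γ ε‖ = 1 := fun ε => by rw [hnorm, hΨ]
    by_cases hΔ : D.delta Ψ = 0
    · subst h0
      exact (D.hasDerivAt_ctot_of_eq_zero hdiff.hasDerivAt hnorm' hΔ
        (hiff.1 hΔ)).differentiableAt
    · obtain ⟨κ, -, hder⟩ := D.exists_hasDerivAt_ctot (hΔ0.lt_of_ne' hΔ)
        (hI0.lt_of_ne' (mt hiff.2 hΔ))
      exact (hder γ _ h0 hnorm' hdiff.hasDerivAt).differentiableAt
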